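/- Let $[-\infty,+\infty]$ be the two-point compactification of $\mathbb{R}$, let $\mathbb{S}^1=\{z\in\mathbb{C}:|z|=1\}$, and let $$X=\big(\{-\infty,+\infty\}\times\mathbb{S}^1\big)\cup\{(x,e^{ix}) : x\in\mathbb{R}\}\subset[-\infty,+\infty]\times\mathbb{S}^1$$ with the subspace topology; $X$ is a compact Hausdorff space. The map $x\mapsto(x,e^{ix})$ identifies $\mathbb{R}$ with a dense subset of $X$. Let $l,\tilde l: X\to\mathbb{S}^1$ be the unique continuous extensions to $X$ of the functions on $\mathbb{R}$ given by $$l(x)=\begin{cases}e^{ix}& x\ge 0\\ 1& x<0\end{cases}\qquad\text{and}\qquad \tilde l(x)=\begin{cases}1& x\ge 0\\ e^{ix}& x<0.\end{cases}$$ They are unitary elements of the unital C$^*$-algebra $C(X)$ of continuous complex-valued functions on $X$. For a unital C$^*$-algebra $A$, let $K_0(A)$ be the Grothendieck group of the monoid of Murray-von Neumann equivalence classes of projections in matrix algebras over $A$ (with the direct sum as addition), and let $K_1(A)=U_\infty(A)/U_\infty(A)_0$ be the (abelian) group of homotopy classes of unitary matrices over $A$, where $u$ is identified with $u\oplus 1$;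 denote by $[p]_0\in K_0(A)$ and $[u]_1\in K_1(A)$ the classes of a projection $p\in A$ and of a unitary $u\in A$. Then $$K_0(C(X))=\mathbb{Z}[1]_0\qquad\text{and}\qquad K_1(C(X))=\mathbb{Z}[l]_1\oplus\mathbb{Z}[\tilde l]_1 ,$$ that is, $K_0(C(X))$ is infinite cyclic with generator $[1]_0$, and $K_1(C(X))$ is free abelian of rank two with basis $[l]_1,[\tilde l]_1$. -/

import Mathlib

noncomputable section

namespace CStarK

universe u

/-! ## The group `K₀` of a unital C⋆-algebra -/

section KZero

variable (A : Type u) [CStarAlgebra A]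

/-- A projection (`p = p² = p⋆`) in one of the matrix algebras `Mₙ(A)`, `n ≥ 0`. -/
structure MatProj where
  size : ℕ
  mat : Matrix (Fin size) (Fin size) A
  isProj : IsStarProjection mat

variable {A}

open Matrix in
/-- Murray-von Neumann equivalence of square matrices of possibly different sizes:
`p = v⋆ v` and `q = v v⋆` for a rectangular matrix `v`. -/
def MvN {ι κ : Type} [Fintype ι] [Fintype κ] (p : Matrix ι ι A) (q : Matrix κ κ A) : Prop :=
  ∃ v : Matrix κ ι A, vᴴ * v = p ∧ v * vᴴ = q

open Matrix in
/-- The direct sum `p ⊕ q`, that is, the block diagonal matrix with blocks `p` and `q`. -/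
def dsum {m n : ℕ} (p : Matrix (Fin m) (Fin m) A) (q : Matrix (Fin n) (Fin n) A) :
    Matrix (Fin (m + n)) (Fin (m + n)) A :=
  (fromBlocks p 0 0 q).submatrix finSumFinEquiv.symm finSumFinEquiv.symm

theorem MvN.refl {ι : Type} [Fintype ι] {p : Matrix ι ι A} (hp : IsStarProjection p) :
    MvN p p := by
  have h1 : p.conjTranspose = p := hp.isSelfAdjoint
  have h2 : p * p = p := hp.isIdempotentElem
  exact ⟨p, by rw [h1, h2], by rw [h1, h2]⟩

theorem MvN.symm {ι κ : Type} [Fintype ι] [Fintype κ] {p : Matrix ι ι A} {q : Matrix κ κ A}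
    (h : MvN p q) : MvN q p := by
  obtain ⟨v, h1, h2⟩ := h
  exact ⟨v.conjTranspose, by simpa using h2, by simpa using h1⟩

theorem MvN.trans {ι κ τ : Type} [Fintype ι] [Fintype κ] [Fintype τ] {p : Matrix ι ι A}
    {q : Matrix κ κ A} {r : Matrix τ τ A} (hp : IsStarProjection p) (hr : IsStarProjection r)
    (h : MvN p q) (h' : MvN q r) : MvN p r := by
  obtain ⟨v, rfl, rfl⟩ := h
  obtain ⟨w, h3, rfl⟩ := h'
  have hp' : v.conjTranspose * v * (v.conjTranspose * v) = v.conjTranspose * v :=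
    hp.isIdempotentElem
  have hr' : w * w.conjTranspose * (w * w.conjTranspose) = w * w.conjTranspose :=
    hr.isIdempotentElem
  refine ⟨w * v, ?_, ?_⟩
  · calc (w * v).conjTranspose * (w * v) = v.conjTranspose * (w.conjTranspose * w) * v := by
          simp only [Matrix.conjTranspose_mul, Matrix.mul_assoc]
      _ = v.conjTranspose * v := by rw [h3, ← hp']; simp only [Matrix.mul_assoc]
  · calc (w * v) * (w * v).conjTranspose = w * (v * v.conjTranspose) * w.conjTranspose := by
          simp only [Matrix.conjTranspose_mul, Matrix.mul_assoc]
      _ = w * w.conjTranspose := by rw [← h3, ← hr']; simp only [Matrix.mul_assoc]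

theorem isStarProjection_submatrix {ι κ : Type} [Fintype ι] [Fintype κ]
    {p : Matrix ι ι A} (hp : IsStarProjection p) (e : κ ≃ ι) :
    IsStarProjection (p.submatrix e e) := by
  have h1 : p.conjTranspose = p := hp.isSelfAdjoint
  have h2 : p * p = p := hp.isIdempotentElem
  constructor
  · change p.submatrix e e * p.submatrix e e = _
    rw [Matrix.submatrix_mul_equiv, h2]
  · change (p.submatrix e e).conjTranspose = _
    rw [Matrix.conjTranspose_submatrix, h1]

theorem isStarProjection_fromBlocks {ι κ : Type} [Fintype ι] [Fintype κ]
    {p : Matrix ι ι A} {q : Matrix κ κ A} (hp : IsStarProjection p) (hq : IsStarProjection q) :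
    IsStarProjection (Matrix.fromBlocks p 0 0 q) := by
  have h1 : p.conjTranspose = p := hp.isSelfAdjoint
  have h2 : p * p = p := hp.isIdempotentElem
  have h3 : q.conjTranspose = q := hq.isSelfAdjoint
  have h4 : q * q = q := hq.isIdempotentElem
  constructor
  · change Matrix.fromBlocks p 0 0 q * Matrix.fromBlocks p 0 0 q = _
    simp [Matrix.fromBlocks_multiply, h2, h4]
  · change (Matrix.fromBlocks p 0 0 q).conjTranspose = _
    simp [Matrix.fromBlocks_conjTranspose, h1, h3]

theorem isStarProjection_dsum {m n : ℕ} {p : Matrix (Fin m) (Fin m) A}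
    {q : Matrix (Fin n) (Fin n) A} (hp : IsStarProjection p) (hq : IsStarProjection q) :
    IsStarProjection (dsum p q) :=
  isStarProjection_submatrix (isStarProjection_fromBlocks hp hq) _

theorem mvN_submatrix {ι κ : Type} [Fintype ι] [Fintype κ]
    {p : Matrix ι ι A} (hp : IsStarProjection p) (e : κ ≃ ι) :
    MvN p (p.submatrix e e) := by
  have h1 : p.conjTranspose = p := hp.isSelfAdjoint
  have h2 : p * p = p := hp.isIdempotentElem
  refine ⟨p.submatrix e id, ?_, ?_⟩
  · rw [Matrix.conjTranspose_submatrix, h1, Matrix.submatrix_mul_equiv, h2,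
      Matrix.submatrix_id_id]
  · rw [Matrix.conjTranspose_submatrix, h1,
      ← Matrix.submatrix_mul p p e id e Function.bijective_id, h2]

theorem mvN_fromBlocks {ι κ ι' κ' : Type} [Fintype ι] [Fintype κ] [Fintype ι'] [Fintype κ']
    {p : Matrix ι ι A} {q : Matrix κ κ A} {p' : Matrix ι' ι' A} {q' : Matrix κ' κ' A}
    (h : MvN p p') (h' : MvN q q') :
    MvN (Matrix.fromBlocks p 0 0 q) (Matrix.fromBlocks p' 0 0 q') := by
  obtain ⟨v, rfl, rfl⟩ := h
  obtain ⟨w, rfl, rfl⟩ := h'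
  refine ⟨Matrix.fromBlocks v 0 0 w, ?_, ?_⟩ <;>
    simp [Matrix.fromBlocks_conjTranspose, Matrix.fromBlocks_multiply]

theorem mvN_dsum {m n m' n' : ℕ}
    {p : Matrix (Fin m) (Fin m) A} {q : Matrix (Fin n) (Fin n) A}
    {p' : Matrix (Fin m') (Fin m') A} {q' : Matrix (Fin n') (Fin n') A}
    (hp : IsStarProjection p) (hq : IsStarProjection q)
    (hp' : IsStarProjection p') (hq' : IsStarProjection q')
    (h : MvN p p') (h' : MvN q q') : MvN (dsum p q) (dsum p' q') := by
  have a := isStarProjection_fromBlocks hp hq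
  have a' := isStarProjection_fromBlocks hp' hq'
  have b := isStarProjection_dsum hp hq
  have b' := isStarProjection_dsum hp' hq'
  exact MvN.trans b b' (mvN_submatrix a _).symm
    (MvN.trans a b' (mvN_fromBlocks h h') (mvN_submatrix a' _))

theorem mvN_dsum_comm {m n : ℕ} {p : Matrix (Fin m) (Fin m) A} {q : Matrix (Fin n) (Fin n) A}
    (hp : IsStarProjection p) (hq : IsStarProjection q) : MvN (dsum p q) (dsum q p) := by
  have b := isStarProjection_dsum hp hq
  have key : dsum q p = (dsum p q).submatrix
      ((finSumFinEquiv.symm.trans (Equiv.sumComm _ _)).trans finSumFinEquiv)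
      ((finSumFinEquiv.symm.trans (Equiv.sumComm _ _)).trans finSumFinEquiv) := by
    ext i j
    obtain ⟨i, rfl⟩ := finSumFinEquiv.surjective i
    obtain ⟨j, rfl⟩ := finSumFinEquiv.surjective j
    rcases i with i | i <;> rcases j with j | j <;>
      simp only [dsum, Matrix.submatrix_apply, Equiv.trans_apply, Equiv.symm_apply_apply,
        Equiv.sumComm_apply, Sum.swap_inl, Sum.swap_inr, Matrix.fromBlocks_apply₁₁,
        Matrix.fromBlocks_apply₁₂, Matrix.fromBlocks_apply₂₁, Matrix.fromBlocks_apply₂₂,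
        Matrix.zero_apply]
  rw [key]
  exact mvN_submatrix b _

theorem mvN_dsum_assoc {l m n : ℕ} {p : Matrix (Fin l) (Fin l) A}
    {q : Matrix (Fin m) (Fin m) A} {r : Matrix (Fin n) (Fin n) A}
    (hp : IsStarProjection p) (hq : IsStarProjection q) (hr : IsStarProjection r) :
    MvN (dsum (dsum p q) r) (dsum p (dsum q r)) := by
  have b := isStarProjection_dsum (isStarProjection_dsum hp hq) hr
  let e : (Fin l ⊕ (Fin m ⊕ Fin n)) ≃ ((Fin l ⊕ Fin m) ⊕ Fin n) := (Equiv.sumAssoc _ _ _).symm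
  let f : Fin (l + (m + n)) ≃ (Fin l ⊕ (Fin m ⊕ Fin n)) :=
    finSumFinEquiv.symm.trans ((Equiv.refl _).sumCongr finSumFinEquiv.symm)
  let g : ((Fin l ⊕ Fin m) ⊕ Fin n) ≃ Fin (l + m + n) :=
    (finSumFinEquiv.sumCongr (Equiv.refl _)).trans finSumFinEquiv
  have key : dsum p (dsum q r) = (dsum (dsum p q) r).submatrix
      ((f.trans e).trans g) ((f.trans e).trans g) := by
    ext i j
    obtain ⟨i, rfl⟩ := f.symm.surjective i
    obtain ⟨j, rfl⟩ := f.symm.surjective j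
    rcases i with i | i | i <;> rcases j with j | j | j <;>
      simp [dsum, e, f, g, -finSumFinEquiv_apply_left, -finSumFinEquiv_apply_right]
  rw [key]
  exact mvN_submatrix b _

theorem mvN_zero_dsum {n : ℕ} {q : Matrix (Fin n) (Fin n) A} (hq : IsStarProjection q) :
    MvN (dsum (0 : Matrix (Fin 0) (Fin 0) A) q) q := by
  have key : dsum (0 : Matrix (Fin 0) (Fin 0) A) q = q.submatrix
      (finSumFinEquiv.symm.trans (Equiv.emptySum (Fin 0) (Fin n)))
      (finSumFinEquiv.symm.trans (Equiv.emptySum (Fin 0) (Fin n))) := by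
    ext i j
    obtain ⟨i, rfl⟩ := finSumFinEquiv.surjective i
    obtain ⟨j, rfl⟩ := finSumFinEquiv.surjective j
    rcases i with i | i
    · exact i.elim0
    rcases j with j | j
    · exact j.elim0
    simp [dsum, -finSumFinEquiv_apply_left, -finSumFinEquiv_apply_right]
  rw [key]
  exact (mvN_submatrix hq _).symm

variable (A)

/-- Murray-von Neumann equivalence on the disjoint union of the projections of all `Mₙ(A)`. -/
instance MatProj.setoid : Setoid (MatProj A) where
  r p q := MvN p.mat q.mat
  iseqv := ⟨fun p => MvN.refl p.isProj, fun h => h.symm,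
    fun {p _ r} h h' => MvN.trans p.isProj r.isProj h h'⟩

/-- The semigroup `D(A)` of Murray-von Neumann classes of projections in matrices over `A`. -/
def ProjClass : Type u := Quotient (MatProj.setoid A)

variable {A}

/-- The direct sum of two matrix projections. -/
def MatProj.sum (p q : MatProj A) : MatProj A :=
  ⟨p.size + q.size, dsum p.mat q.mat, isStarProjection_dsum p.isProj q.isProj⟩

/-- The class in `D(A)` of a matrix projection. -/
def ProjClass.mk (p : MatProj A) : ProjClass A := Quotient.mk (MatProj.setoid A) p

/-- Addition on `D(A)` is the direct sum of representatives. -/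
instance : AddCommMonoid (ProjClass A) where
  add := Quotient.map₂ MatProj.sum fun p p' h q q' h' =>
    mvN_dsum p.isProj q.isProj p'.isProj q'.isProj h h'
  zero := ProjClass.mk ⟨0, 0, IsStarProjection.zero _⟩
  add_assoc := by
    rintro ⟨p⟩ ⟨q⟩ ⟨r⟩
    exact Quotient.sound (s := MatProj.setoid A) (mvN_dsum_assoc p.isProj q.isProj r.isProj)
  zero_add := by
    rintro ⟨p⟩
    exact Quotient.sound (s := MatProj.setoid A) (mvN_zero_dsum p.isProj)
  add_zero := by
    rintro ⟨p⟩
    have z : IsStarProjection (0 : Matrix (Fin 0) (Fin 0) A) := IsStarProjection.zero _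
    exact Quotient.sound (s := MatProj.setoid A) (MvN.trans (isStarProjection_dsum p.isProj z)
      p.isProj (mvN_dsum_comm p.isProj z) (mvN_zero_dsum p.isProj))
  add_comm := by
    rintro ⟨p⟩ ⟨q⟩
    exact Quotient.sound (s := MatProj.setoid A) (mvN_dsum_comm p.isProj q.isProj)
  nsmul := @nsmulRec _ ⟨ProjClass.mk ⟨0, 0, IsStarProjection.zero _⟩⟩
    ⟨Quotient.map₂ MatProj.sum fun p p' h q q' h' =>
      mvN_dsum p.isProj q.isProj p'.isProj q'.isProj h h'⟩

variable (A)

/-- `K₀(A)` for a unital C⋆-algebra `A`: the Grothendieck group of `D(A)`. -/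
abbrev KZero : Type u := Algebra.GrothendieckAddGroup (ProjClass A)

variable {A}

theorem isStarProjection_oneByOne {p : A} (hp : IsStarProjection p) :
    IsStarProjection (Matrix.diagonal fun _ : Fin 1 => p) := by
  have h1 : star p = p := hp.isSelfAdjoint
  have h2 : p * p = p := hp.isIdempotentElem
  constructor
  · change Matrix.diagonal _ * Matrix.diagonal _ = _
    rw [Matrix.diagonal_mul_diagonal]
    simp only [h2]
  · change (Matrix.diagonal _).conjTranspose = _
    rw [Matrix.diagonal_conjTranspose]
    congr 1
    funext i
    exact h1

/-- The class `[p]₀` of a projection `p` of `A`, regarded as a `1 × 1` matrix. -/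
def classZero (p : A) (hp : IsStarProjection p) : KZero A :=
  Algebra.GrothendieckAddGroup.of (ProjClass.mk ⟨1, _, isStarProjection_oneByOne hp⟩)

end KZero

/-! ## The group `K₁` of a unital C⋆-algebra -/

section KOne

variable (A : Type u) [CStarAlgebra A]

/-- The unitary group `Uₙ(A)` of `Mₙ(A)`. Its topology is the entrywise one; this is the topology
of the C⋆-norm of `Mₙ(A)`. -/
abbrev UMat (n : ℕ) : Type u := unitary (Matrix (Fin n) (Fin n) A)

/-- The topology of `Mₙ(A)` used here is the norm topology of the C⋆-algebra of matrices. -/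
theorem isHomeomorph_ofMatrix (n : ℕ) : IsHomeomorph
    (CStarMatrix.ofMatrix : Matrix (Fin n) (Fin n) A → CStarMatrix (Fin n) (Fin n) A) :=
  (CStarMatrix.ofMatrixL (m := Fin n) (n := Fin n) (A := A)).toHomeomorph.isHomeomorph

variable {A}

/-- The matrix `u ⊕ 1` in `M_m(A)`, for `u` in `M_n(A)` and `n ≤ m`. -/
def pad {n : ℕ} (m : ℕ) (u : Matrix (Fin n) (Fin n) A) : Matrix (Fin m) (Fin m) A :=
  fun i j => if h : (i : ℕ) < n ∧ (j : ℕ) < n then u ⟨i, h.1⟩ ⟨j, h.2⟩ else if i = j then 1 else 0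

theorem pad_add {n k : ℕ} (u : Matrix (Fin n) (Fin n) A) : pad (n + k) u = dsum u 1 := by
  ext i j
  refine Fin.addCases (fun i => ?_) (fun i => ?_) i <;>
    refine Fin.addCases (fun j => ?_) (fun j => ?_) j
  · simp [pad, dsum]
  · have : Fin.castAdd k i ≠ Fin.natAdd n j := by
      intro h
      have := congrArg Fin.val h
      simp at this
      omega
    simp [pad, dsum, this]
  · have : Fin.natAdd n i ≠ Fin.castAdd k j := by
      intro h
      have := congrArg Fin.val h
      simp at this
      omega
    simp [pad, dsum, this]
  · simp [pad, dsum, Matrix.one_apply]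

theorem pad_one {n m : ℕ} (h : n ≤ m) : pad m (1 : Matrix (Fin n) (Fin n) A) = 1 := by
  obtain ⟨k, rfl⟩ := Nat.exists_eq_add_of_le h
  rw [pad_add, dsum, Matrix.fromBlocks_one, Matrix.submatrix_one_equiv]

theorem pad_mul {n m : ℕ} (h : n ≤ m) (u v : Matrix (Fin n) (Fin n) A) :
    pad m (u * v) = pad m u * pad m v := by
  obtain ⟨k, rfl⟩ := Nat.exists_eq_add_of_le h
  simp only [pad_add, dsum]
  rw [Matrix.submatrix_mul_equiv, Matrix.fromBlocks_multiply]
  simp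

theorem pad_star {n m : ℕ} (h : n ≤ m) (u : Matrix (Fin n) (Fin n) A) :
    pad m (star u) = star (pad m u) := by
  obtain ⟨k, rfl⟩ := Nat.exists_eq_add_of_le h
  simp only [pad_add, dsum, Matrix.star_eq_conjTranspose, Matrix.conjTranspose_submatrix,
    Matrix.fromBlocks_conjTranspose]
  simp

theorem pad_self {n : ℕ} (u : Matrix (Fin n) (Fin n) A) : pad n u = u := by
  ext i j
  simp [pad]

theorem pad_pad {n m k : ℕ} (hnm : n ≤ m) (u : Matrix (Fin n) (Fin n) A) :
    pad k (pad m u) = pad k u := by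
  ext i j
  simp only [pad]
  by_cases h : (i : ℕ) < n ∧ (j : ℕ) < n
  · have h' : (i : ℕ) < m ∧ (j : ℕ) < m := ⟨by omega, by omega⟩
    simp [h, h']
  · by_cases h' : (i : ℕ) < m ∧ (j : ℕ) < m
    · simp [h, h', Fin.ext_iff]
    · simp [h, h']

theorem continuous_pad {n : ℕ} (m : ℕ) :
    Continuous (pad m : Matrix (Fin n) (Fin n) A → Matrix (Fin m) (Fin m) A) := by
  refine continuous_matrix fun i j => ?_
  unfold pad
  split_ifs
  · exact continuous_id.matrix_elem _ _
  · exact continuous_const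
  · exact continuous_const

variable (A)

/-- The connecting homomorphism `Uₙ(A) → U_m(A)`, `u ↦ u ⊕ 1`, for `n ≤ m`. -/
def padHom (n m : ℕ) (h : n ≤ m) : UMat A n →* UMat A m where
  toFun u := ⟨pad m u.1, by
    rw [Unitary.mem_iff, ← pad_star h, ← pad_mul h, ← pad_mul h,
      Unitary.star_mul_self_of_mem u.2, Unitary.mul_star_self_of_mem u.2, pad_one h]
    exact ⟨rfl, rfl⟩⟩
  map_one' := Subtype.ext (pad_one h)
  map_mul' u v := Subtype.ext (pad_mul h u.1 v.1)

instance : DirectedSystem (UMat A) (fun _ _ h => padHom A _ _ h) where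
  map_self _ u := Subtype.ext (pad_self u.1)
  map_map _ _ _ hij _ u := Subtype.ext (pad_pad hij u.1)

/-- The group `U_∞(A)`, the union of the groups `Uₙ(A)` along the inclusions `u ↦ u ⊕ 1`. -/
abbrev UInfty : Type u := DirectLimit (UMat A) (padHom A)

variable {A}

/-- The element of `U_∞(A)` represented by a unitary matrix. -/
def UInfty.mk {n : ℕ} (u : UMat A n) : UInfty A := ⟦⟨n, u⟩⟧

theorem UInfty.mk_mul {n : ℕ} (u v : UMat A n) : mk (u * v) = mk u * mk v :=
  (DirectLimit.mul_def (f := padHom A) n u v).symm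

theorem UInfty.mk_inv {n : ℕ} (u : UMat A n) : mk u⁻¹ = (mk u)⁻¹ := rfl

theorem UInfty.mk_one (n : ℕ) : mk (1 : UMat A n) = 1 :=
  (DirectLimit.one_def (f := padHom A) n).symm

theorem UInfty.mk_pad {n m : ℕ} (h : n ≤ m) (u : UMat A n) : mk (padHom A n m h u) = mk u :=
  DirectLimit.mk_apply (f := padHom A) n m u h

theorem continuous_padHom {n m : ℕ} (h : n ≤ m) : Continuous (padHom A n m h) :=
  ((continuous_pad m).comp continuous_subtype_val).subtype_mk _

theorem joined_one_padHom {n m : ℕ} (h : n ≤ m) {u : UMat A n} (hu : Joined 1 u) :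
    Joined 1 (padHom A n m h u) := by
  have := hu.map (continuous_padHom h)
  rwa [map_one] at this

theorem joined_one_mul {G : Type*} [TopologicalSpace G] [Monoid G] [ContinuousMul G] {u v : G}
    (hu : Joined 1 u) (hv : Joined 1 v) : Joined 1 (u * v) := by
  simpa using hu.mul hv

variable (A)

/-- The subgroup `U_∞(A)₀` of all elements represented by some `u` in some `Uₙ(A)` that can be
joined to `1` by a continuous path in `Uₙ(A)`. -/
def UInftyZero : Subgroup (UInfty A) where
  carrier := {x | ∃ (n : ℕ) (u : UMat A n), Joined 1 u ∧ UInfty.mk u = x}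
  one_mem' := ⟨0, 1, Joined.refl _, UInfty.mk_one 0⟩
  mul_mem' := by
    rintro _ _ ⟨n, u, hu, rfl⟩ ⟨m, v, hv, rfl⟩
    refine ⟨max n m, padHom A _ _ (le_max_left n m) u * padHom A _ _ (le_max_right n m) v,
      joined_one_mul (joined_one_padHom _ hu) (joined_one_padHom _ hv), ?_⟩
    rw [UInfty.mk_mul, UInfty.mk_pad, UInfty.mk_pad]
  inv_mem' := by
    rintro _ ⟨n, u, hu, rfl⟩
    refine ⟨n, u⁻¹, ?_, UInfty.mk_inv u⟩
    have := hu.map (continuous_inv (G := UMat A n))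
    simpa using this

variable {A}

theorem UInfty.exists_rep₂ (x y : UInfty A) :
    ∃ (n : ℕ) (u v : UMat A n), x = UInfty.mk u ∧ y = UInfty.mk v :=
  DirectLimit.exists_eq_mk₂ (padHom A) x y

instance : (UInftyZero A).Normal where
  conj_mem := by
    rintro _ ⟨n, u, hu, rfl⟩ g
    obtain ⟨m, v, rfl⟩ := DirectLimit.exists_eq_mk (padHom A) g
    change UInfty.mk v * UInfty.mk u * (UInfty.mk v)⁻¹ ∈ _
    refine ⟨max n m, padHom A _ _ (le_max_right n m) v * padHom A _ _ (le_max_left n m) u *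
      (padHom A _ _ (le_max_right n m) v)⁻¹, ?_, ?_⟩
    · have := (((Joined.refl (padHom A _ _ (le_max_right n m) v)).mul
        (joined_one_padHom (le_max_left n m) hu)).mul
        (Joined.refl (padHom A _ _ (le_max_right n m) v)⁻¹))
      simpa using this
    · rw [UInfty.mk_mul, UInfty.mk_mul, UInfty.mk_inv, UInfty.mk_pad, UInfty.mk_pad]

/-- The rotation matrix by the angle `t` in `M₂(Mₙ(A)) = M₂ₙ(A)`. -/
def rotMat (A : Type u) [CStarAlgebra A] (n : ℕ) (t : ℝ) :
    Matrix (Fin (n + n)) (Fin (n + n)) A :=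
  (Matrix.fromBlocks ((Real.cos t : ℂ) • 1) (-((Real.sin t : ℂ) • 1)) ((Real.sin t : ℂ) • 1)
    ((Real.cos t : ℂ) • 1)).submatrix finSumFinEquiv.symm finSumFinEquiv.symm

theorem rotMat_mem (n : ℕ) (t : ℝ) : rotMat A n t ∈ unitary (Matrix (Fin (n + n)) _ A) := by
  have h : (Real.cos t : ℂ) * (Real.cos t : ℂ) + (Real.sin t : ℂ) * (Real.sin t : ℂ) = 1 := by
    exact_mod_cast (by nlinarith [Real.sin_sq_add_cos_sq t] :
      Real.cos t * Real.cos t + Real.sin t * Real.sin t = 1)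
  rw [Unitary.mem_iff]
  simp only [rotMat, Matrix.star_eq_conjTranspose, Matrix.conjTranspose_submatrix,
    Matrix.fromBlocks_conjTranspose, Matrix.submatrix_mul_equiv, Matrix.fromBlocks_multiply,
    Matrix.conjTranspose_neg, Matrix.conjTranspose_smul, Matrix.conjTranspose_one,
    Complex.star_def, Complex.conj_ofReal, smul_mul_smul_comm, mul_one, neg_mul, mul_neg, neg_neg,
    ← add_smul, h, one_smul]
  have h' : (Real.sin t : ℂ) * (Real.sin t : ℂ) + (Real.cos t : ℂ) * (Real.cos t : ℂ) = 1 := by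
    rw [add_comm]; exact h
  simp only [h', one_smul, mul_comm (Real.sin t : ℂ) (Real.cos t : ℂ), neg_add_cancel,
    add_neg_cancel, Matrix.fromBlocks_one, Matrix.submatrix_one_equiv, and_self]

theorem joined_one_rotMat (n : ℕ) :
    Joined (1 : UMat A (n + n)) ⟨rotMat A n (Real.pi / 2), rotMat_mem n _⟩ := by
  have hc : Continuous fun t : ℝ => (⟨rotMat A n t, rotMat_mem n t⟩ : UMat A (n + n)) := by
    refine Continuous.subtype_mk ?_ _
    unfold rotMat
    refine Continuous.matrix_submatrix (Continuous.matrix_fromBlocks ?_ ?_ ?_ ?_) _ _ <;> fun_prop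
  have h0 : (⟨rotMat A n 0, rotMat_mem n 0⟩ : UMat A (n + n)) = 1 := by
    apply Subtype.ext
    simp [rotMat, Matrix.fromBlocks_one]
  rw [← h0]
  exact (PathConnectedSpace.joined (0 : ℝ) (Real.pi / 2)).map hc

theorem commutator_mem (x y : UInfty A) : x * y * x⁻¹ * y⁻¹ ∈ UInftyZero A := by
  obtain ⟨n, u, v, rfl, rfl⟩ := UInfty.exists_rep₂ x y
  have hn : n ≤ n + n := Nat.le_add_left n n
  set U := padHom A n (n + n) hn u with hU
  set V := padHom A n (n + n) hn v with hV
  set R : UMat A (n + n) := ⟨rotMat A n (Real.pi / 2), rotMat_mem n _⟩ with hR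
  have hcomm : U * (R * V * R⁻¹) = (R * V * R⁻¹) * U := by
    have key : (R * V * R⁻¹ : UMat A (n + n)) =
        (dsum 1 v.1 : Matrix (Fin (n + n)) (Fin (n + n)) A) := by
      change rotMat A n (Real.pi / 2) * pad (n + n) v.1 * star (rotMat A n (Real.pi / 2)) = _
      rw [pad_add]
      simp [rotMat, dsum, Matrix.star_eq_conjTranspose, Matrix.submatrix_mul_equiv,
        Matrix.fromBlocks_conjTranspose, Matrix.fromBlocks_multiply]
    apply Subtype.ext
    change U.1 * (R * V * R⁻¹ : UMat A (n + n)).1 = (R * V * R⁻¹ : UMat A (n + n)).1 * U.1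
    have hU' : U.1 = dsum u.1 1 := pad_add u.1
    rw [key, hU']
    simp [dsum, Matrix.submatrix_mul_equiv, Matrix.fromBlocks_multiply]
  have hj : Joined 1 R := joined_one_rotMat n
  have hj' : Joined 1 R⁻¹ := by simpa using hj.map (continuous_inv (G := UMat A (n + n)))
  have p1 : Joined (U * (1 * V * 1) * U⁻¹ * (1 * V * 1)⁻¹)
      (U * (R * V * R⁻¹) * U⁻¹ * (R * V * R⁻¹)⁻¹) := by
    have a : Joined (1 * V * 1) (R * V * R⁻¹) := (hj.mul (Joined.refl V)).mul hj'
    exact (((Joined.refl U).mul a).mul (Joined.refl U⁻¹)).mul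
      (a.map (continuous_inv (G := UMat A (n + n))))
  rw [hcomm] at p1
  have p2 : Joined 1 (U * V * U⁻¹ * V⁻¹) := by
    have := p1.symm
    simpa [mul_assoc] using this
  refine ⟨n + n, _, p2, ?_⟩
  simp only [UInfty.mk_mul, UInfty.mk_inv, hU, hV, UInfty.mk_pad]

instance : CommGroup (UInfty A ⧸ UInftyZero A) where
  __ := (inferInstance : Group (UInfty A ⧸ UInftyZero A))
  mul_comm := by
    rintro ⟨x⟩ ⟨y⟩
    change ((x * y : UInfty A) : UInfty A ⧸ UInftyZero A) = ((y * x : UInfty A) : _)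
    rw [eq_comm, QuotientGroup.eq]
    have := commutator_mem x⁻¹ y⁻¹
    simpa [mul_assoc] using this

variable (A)

/-- `K₁(A) = U_∞(A) / U_∞(A)₀` for a unital C⋆-algebra `A`, written additively. -/
abbrev KOne : Type u := Additive (UInfty A ⧸ UInftyZero A)

variable {A}

/-- A unitary element of `A` as a unitary `1 × 1` matrix. -/
def oneByOne (u : unitary A) : UMat A 1 :=
  ⟨Matrix.diagonal fun _ => (u : A), by
    rw [Unitary.mem_iff]
    simp [Matrix.star_eq_conjTranspose, Matrix.diagonal_conjTranspose,
      Matrix.diagonal_mul_diagonal]⟩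

/-- The class `[u]₁` of a unitary element `u` of `A`, regarded as a `1 × 1` matrix. -/
def classOne (u : unitary A) : KOne A :=
  Additive.ofMul (QuotientGroup.mk (UInfty.mk (oneByOne u)))

end KOne

end CStarK

/-! ## The space `X` and the functions `l` and `l̃` -/

/-- The two boundary circles of the cylinder `[-∞, +∞] × S¹`, together with the spiral
`x ↦ (x, e^{ix})`, `x ∈ ℝ`. -/
def spiralSet : Set (EReal × Circle) :=
  {p | p.1 = ⊤ ∨ p.1 = ⊥ ∨ ∃ x : ℝ, p = ((x : EReal), Circle.exp x)}

/-- The space `X`, with the subspace topology of `[-∞, +∞] × S¹`. -/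
abbrev SpiralSpace : Type := spiralSet

theorem isClosed_spiralSet : IsClosed spiralSet := by
  rw [← isOpen_compl_iff]
  have hs : IsOpen ((Prod.fst : EReal × Circle → EReal) ⁻¹' {⊥, ⊤}ᶜ) :=
    ((Set.toFinite ({⊥, ⊤} : Set EReal)).isClosed.isOpen_compl).preimage continuous_fst
  have hf : ContinuousOn (fun p : EReal × Circle => Circle.exp p.1.toReal * p.2⁻¹)
      ((Prod.fst : EReal × Circle → EReal) ⁻¹' {⊥, ⊤}ᶜ) := by
    refine ContinuousOn.mul ?_ (continuous_snd.inv.continuousOn)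
    exact Circle.exp.continuous.comp_continuousOn
      (EReal.continuousOn_toReal.comp continuous_fst.continuousOn fun p hp => hp)
  convert hf.isOpen_inter_preimage hs (isOpen_compl_singleton (x := (1 : Circle))) using 1
  ext ⟨x, z⟩
  induction x using EReal.rec with
  | bot => simp [spiralSet]
  | top => simp [spiralSet]
  | coe x =>
    simp only [spiralSet, Set.mem_compl_iff, Set.mem_ofPred_eq, EReal.coe_ne_top, EReal.coe_ne_bot,
      false_or, Prod.mk.injEq, EReal.coe_eq_coe_iff, Set.mem_inter_iff, Set.mem_preimage,
      Set.mem_insert_iff, Set.mem_singleton_iff, or_self, not_false_eq_true, true_and,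
      EReal.toReal_coe, mul_inv_eq_one]
    refine not_congr ⟨?_, fun h => ⟨x, rfl, h.symm⟩⟩
    rintro ⟨y, rfl, h⟩
    exact h.symm

instance : CompactSpace SpiralSpace := isCompact_iff_compactSpace.mp isClosed_spiralSet.isCompact

namespace SpiralSpace

/-- The inclusion `x ↦ (x, e^{ix})` of `ℝ` in `X`. -/
def ofReal (x : ℝ) : SpiralSpace := ⟨((x : EReal), Circle.exp x), Or.inr (Or.inr ⟨x, rfl⟩)⟩

theorem snd_eq_one_of_fst_eq_zero (p : SpiralSpace) (h : 0 = p.1.1) : p.1.2 = 1 := by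
  obtain ⟨⟨x, z⟩, hp⟩ := p
  simp only at h
  subst h
  rcases hp with hp | hp | ⟨y, hp⟩
  · simp at hp
  · simp at hp
  · simp only [Prod.mk.injEq] at hp
    have : y = 0 := by exact_mod_cast hp.1.symm
    simp [hp.2, this]

open Classical in
/-- The function `l` on `X` with values in `S¹`: `l (x, z) = z` if `x ≥ 0` and `1` otherwise, so
that on `ℝ ⊆ X` it is `e^{ix}` for `x ≥ 0` and `1` for `x < 0`. -/
def lCircle : C(SpiralSpace, Circle) where
  toFun p := if 0 ≤ p.1.1 then p.1.2 else 1
  continuous_toFun := by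
    refine Continuous.if_le (by fun_prop) (by fun_prop) (by fun_prop) (by fun_prop) ?_
    exact fun p h => snd_eq_one_of_fst_eq_zero p h

open Classical in
/-- The function `l̃` on `X` with values in `S¹`: `l̃ (x, z) = 1` if `x ≥ 0` and `z` otherwise, so
that on `ℝ ⊆ X` it is `1` for `x ≥ 0` and `e^{ix}` for `x < 0`. -/
def lTildeCircle : C(SpiralSpace, Circle) where
  toFun p := if 0 ≤ p.1.1 then 1 else p.1.2
  continuous_toFun := by
    refine Continuous.if_le (by fun_prop) (by fun_prop) (by fun_prop) (by fun_prop) ?_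
    exact fun p h => (snd_eq_one_of_fst_eq_zero p h).symm

theorem lCircle_ofReal (x : ℝ) : lCircle (ofReal x) = if 0 ≤ x then Circle.exp x else 1 := by
  simp [lCircle, ofReal]

theorem lTildeCircle_ofReal (x : ℝ) :
    lTildeCircle (ofReal x) = if 0 ≤ x then 1 else Circle.exp x := by
  simp [lTildeCircle, ofReal]

/-- The points of `ℝ` are dense in `X`, so a continuous extension from `ℝ` to `X` is unique. -/
theorem denseRange_ofReal : DenseRange ofReal := by
  have hper : ∀ (t : ℝ) (n : ℤ), Circle.exp (t + n * (2 * Real.pi)) = Circle.exp t :=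
    fun t n => Circle.periodic_exp.int_mul n t
  rintro ⟨⟨x, z⟩, hp⟩
  rcases hp with hp | hp | ⟨y, hp⟩
  · simp only at hp
    subst hp
    have hlim : Filter.Tendsto (fun n : ℕ => ofReal (Complex.arg z + (n : ℤ) * (2 * Real.pi)))
        Filter.atTop (nhds ⟨(⊤, z), Or.inl rfl⟩) := by
      rw [tendsto_subtype_rng]
      refine Filter.Tendsto.prodMk_nhds ?_ ?_
      · refine EReal.tendsto_coe_nhds_top_iff.mpr ?_
        refine Filter.tendsto_atTop_add_const_left _ _ ?_
        push_cast
        exact Filter.Tendsto.atTop_mul_const (by positivity) tendsto_natCast_atTop_atTop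
      · simp only [hper, Circle.exp_arg]
        exact tendsto_const_nhds
    exact mem_closure_of_tendsto hlim (Filter.Eventually.of_forall fun n => ⟨_, rfl⟩)
  · simp only at hp
    subst hp
    have hlim : Filter.Tendsto
        (fun n : ℕ => ofReal (Complex.arg z + ((-n : ℤ) : ℝ) * (2 * Real.pi)))
        Filter.atTop (nhds ⟨(⊥, z), Or.inr (Or.inl rfl)⟩) := by
      rw [tendsto_subtype_rng]
      refine Filter.Tendsto.prodMk_nhds ?_ ?_
      · refine EReal.tendsto_coe_nhds_bot_iff.mpr ?_
        refine Filter.tendsto_atBot_add_const_left _ _ ?_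
        push_cast
        exact Filter.Tendsto.atBot_mul_const (by positivity)
          (Filter.tendsto_neg_atTop_atBot.comp tendsto_natCast_atTop_atTop)
      · simp only [hper, Circle.exp_arg]
        exact tendsto_const_nhds
    exact mem_closure_of_tendsto hlim (Filter.Eventually.of_forall fun n => ⟨_, rfl⟩)
  · apply subset_closure
    exact ⟨y, Subtype.ext hp.symm⟩

/-- A continuous function with values in `S¹`, as a unitary element of the C⋆-algebra `C(X)`. -/
def toUnitary (f : C(SpiralSpace, Circle)) : unitary C(SpiralSpace, ℂ) :=
  ⟨⟨fun p => (f p : ℂ), by fun_prop⟩, by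
    rw [Unitary.mem_iff]
    constructor <;> ext p <;> simp [Complex.conj_mul', Complex.mul_conj', Circle.norm_coe]⟩

/-- The unitary `l` of `C(X)`. -/
def l : unitary C(SpiralSpace, ℂ) := toUnitary lCircle

/-- The unitary `l̃` of `C(X)`. -/
def lTilde : unitary C(SpiralSpace, ℂ) := toUnitary lTildeCircle

end SpiralSpace

end

/-!
The space `X` is one-dimensional: it is a union of three smooth curves, the line and the two
boundary circles. Both halves of the theorem rest on one consequence of this, that the invertible
functions are dense in `C(X)` (`SpiralSpace.dense_isUnit`). By the Stone-Weierstrass theorem every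
function is a uniform limit of functions that are smooth along the three curves. The range of such
a function has Hausdorff dimension at most one, so it omits arbitrarily small complex numbers, and
subtracting one of these makes the function invertible.

For `K₀`, let `p` be a projection over `C(X)`. As `X` is connected, its rank is constant, and if it
is not zero then the columns of `p` have no common zero. Density of the invertible functions
gives a combination of the columns without zeros (`CStarK.exists_mulVec_ne_zero`), because two
sections `s`, `t` without common zeros have a combination `s + y t` without zeros. Normalized, this
is a vector of length one fixed by `p`, and it splits off a trivial summand
(`CStarK.exists_mvN_dsum_one`). Induction on the rank shows that `p` is trivial, so `[1]₀`
generates, and the trace shows that it has infinite order.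

For `K₁`, a unitary matrix can be perturbed so that its last entry is invertible; elementary
operations then split off this entry, and polar decomposition turns the path of invertible matrices
into one of unitary matrices (`CStarK.exists_joined_dsumU`). Hence every class is that of a function
`w : X → S¹`. On the circles at `+∞` and `-∞` the function `w` has winding numbers `m` and `n`, and
`w * l ^ (-m) * l̃ ^ (-n)` has logarithms on both circles. These extend to `X` by Tietze's theorem;
after division by the exponential of the extension there remains a function that is trivial on both
circles, thus a function on `[-∞, +∞]`, which has a logarithm by path lifting
(`SpiralSpace.exists_eq_zpow_mul_zpow_mul_exp`). So `[l]₁` and `[l̃]₁` generate. Conversely, if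
`l ^ m * l̃ ^ n` represents zero, then by taking determinants it is joined to `1`, so it has a
logarithm (`SpiralSpace.exists_eq_circleExp_of_joined`), and restriction to the circles gives
`m = n = 0`.
-/

noncomputable section

/-! ### A coordinate on the extended real line -/

/-- The increasing map `x ↦ arctan x / π + 1 / 2` from `[-∞, +∞]` to `[0, 1]`. -/
def EReal.arctanUnit : EReal → ℝ
  | ⊥ => 0
  | ⊤ => 1
  | (x : ℝ) => Real.arctan x / Real.pi + 1 / 2

theorem EReal.arctanUnit_coe (x : ℝ) :
    EReal.arctanUnit x = Real.arctan x / Real.pi + 1 / 2 := rfl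

theorem EReal.arctanUnit_coe_mem (x : ℝ) : EReal.arctanUnit x ∈ Set.Ioo (0 : ℝ) 1 := by
  rw [EReal.arctanUnit_coe]
  have h1 := Real.neg_pi_div_two_lt_arctan x
  have h2 := Real.arctan_lt_pi_div_two x
  have hpi := Real.pi_pos
  have h3 : -(1 / 2) < Real.arctan x / Real.pi := by rw [lt_div_iff₀ hpi]; linarith
  have h4 : Real.arctan x / Real.pi < 1 / 2 := by rw [div_lt_iff₀ hpi]; linarith
  constructor <;> linarith

theorem EReal.strictMono_arctanUnit : StrictMono EReal.arctanUnit := by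
  intro x y h
  induction x using EReal.rec with
  | top => exact absurd h not_top_lt
  | bot =>
    induction y using EReal.rec with
    | bot => exact absurd h (lt_irrefl _)
    | top => exact zero_lt_one
    | coe y => exact (EReal.arctanUnit_coe_mem y).1
  | coe x =>
    induction y using EReal.rec with
    | bot => exact absurd h not_lt_bot
    | top => exact (EReal.arctanUnit_coe_mem x).2
    | coe y =>
      rw [EReal.arctanUnit_coe, EReal.arctanUnit_coe]
      have := Real.arctan_strictMono (EReal.coe_lt_coe_iff.mp h)
      have hpi := Real.pi_pos
      gcongr

theorem EReal.range_arctanUnit : Set.range EReal.arctanUnit = unitInterval := by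
  apply Set.Subset.antisymm
  · rintro _ ⟨x, rfl⟩
    induction x using EReal.rec with
    | bot => exact unitInterval.zero_mem
    | top => exact unitInterval.one_mem
    | coe x => exact Set.Ioo_subset_Icc_self (EReal.arctanUnit_coe_mem x)
  · rintro y ⟨h0, h1⟩
    rcases h0.eq_or_lt with rfl | h0
    · exact ⟨⊥, rfl⟩
    rcases h1.eq_or_lt with rfl | h1
    · exact ⟨⊤, rfl⟩
    refine ⟨(Real.tan ((y - 1 / 2) * Real.pi) : ℝ), ?_⟩
    have hpi := Real.pi_pos
    rw [EReal.arctanUnit_coe, Real.arctan_tan (by nlinarith) (by nlinarith)]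
    field_simp
    ring

/-- The extended real line is homeomorphic to the unit interval. -/
def EReal.homeomorphUnitInterval : EReal ≃ₜ unitInterval :=
  ((EReal.strictMono_arctanUnit.orderIso _).trans
    (OrderIso.setCongr _ _ EReal.range_arctanUnit)).toHomeomorph

theorem EReal.continuous_arctanUnit : Continuous EReal.arctanUnit :=
  continuous_subtype_val.comp EReal.homeomorphUnitInterval.continuous

namespace SpiralSpace

/-! ### Density of the invertible functions -/

/-- The boundary circle of `X` over `+∞`. -/
def circleTop : C(Circle, SpiralSpace) where
  toFun z := ⟨(⊤, z), Or.inl rfl⟩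

/-- The boundary circle of `X` over `-∞`. -/
def circleBot : C(Circle, SpiralSpace) where
  toFun z := ⟨(⊥, z), Or.inr (Or.inl rfl)⟩

theorem continuous_ofReal : Continuous ofReal :=
  (continuous_coe_real_ereal.prodMk Circle.exp.continuous).subtype_mk _

/-- Every point of `X` lies on the line or on one of the two circles. -/
theorem cases_ofReal_circle {P : SpiralSpace → Prop} (h : ∀ x, P (ofReal x))
    (htop : ∀ z, P (circleTop z)) (hbot : ∀ z, P (circleBot z)) (p : SpiralSpace) : P p := by
  obtain ⟨⟨x, z⟩, hx | hx | ⟨y, hy⟩⟩ := p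
  · obtain rfl : x = ⊤ := hx
    exact htop z
  · obtain rfl : x = ⊥ := hx
    exact hbot z
  · obtain ⟨rfl, rfl⟩ := Prod.mk.inj hy
    exact h y

instance : PreconnectedSpace SpiralSpace :=
  denseRange_ofReal.preconnectedSpace continuous_ofReal

/-- The functions on `X` that are continuously differentiable along the line and along both
circles. -/
def smoothFunctions : StarSubalgebra ℂ C(SpiralSpace, ℂ) where
  carrier := {f | ContDiff ℝ 1 (fun x => f (ofReal x)) ∧
    ContDiff ℝ 1 (fun t => f (circleTop (Circle.exp t))) ∧
    ContDiff ℝ 1 (fun t => f (circleBot (Circle.exp t)))}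
  mul_mem' := fun ⟨h1, h2, h3⟩ ⟨k1, k2, k3⟩ => ⟨h1.mul k1, h2.mul k2, h3.mul k3⟩
  add_mem' := fun ⟨h1, h2, h3⟩ ⟨k1, k2, k3⟩ => ⟨h1.add k1, h2.add k2, h3.add k3⟩
  algebraMap_mem' _ := ⟨contDiff_const, contDiff_const, contDiff_const⟩
  star_mem' := fun ⟨h1, h2, h3⟩ => ⟨Complex.conjCLE.contDiff.comp h1,
    Complex.conjCLE.contDiff.comp h2, Complex.conjCLE.contDiff.comp h3⟩

/-- A coordinate on `[-∞, +∞]`, as a function on `X`. -/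
def fstFunction : C(SpiralSpace, ℂ) where
  toFun p := (EReal.arctanUnit p.1.1 : ℝ)
  continuous_toFun := Complex.continuous_ofReal.comp
    (EReal.continuous_arctanUnit.comp (continuous_fst.comp continuous_subtype_val))

/-- The circle coordinate, as a function on `X`. -/
def sndFunction : C(SpiralSpace, ℂ) where
  toFun p := (p.1.2 : ℂ)

theorem contDiff_circleExp : ContDiff ℝ 1 fun t : ℝ => (Circle.exp t : ℂ) := by
  simp only [Circle.coe_exp]
  exact (Complex.ofRealCLM.contDiff.mul contDiff_const).cexp

theorem fstFunction_mem : fstFunction ∈ smoothFunctions :=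
  ⟨Complex.ofRealCLM.contDiff.comp ((Real.contDiff_arctan.div_const _).add contDiff_const),
    contDiff_const (c := ((1 : ℝ) : ℂ)), contDiff_const (c := ((0 : ℝ) : ℂ))⟩

theorem sndFunction_mem : sndFunction ∈ smoothFunctions :=
  ⟨contDiff_circleExp, contDiff_circleExp, contDiff_circleExp⟩

theorem topologicalClosure_smoothFunctions : smoothFunctions.topologicalClosure = ⊤ := by
  apply ContinuousMap.starSubalgebra_topologicalClosure_eq_top_of_separatesPoints
  intro p q hpq
  by_contra! H
  have h1 : EReal.arctanUnit p.1.1 = EReal.arctanUnit q.1.1 := by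
    exact Complex.ofReal_injective (H _ ⟨fstFunction, fstFunction_mem, rfl⟩)
  have h2 : (p.1.2 : ℂ) = q.1.2 := H _ ⟨sndFunction, sndFunction_mem, rfl⟩
  exact hpq (Subtype.ext (Prod.ext (EReal.strictMono_arctanUnit.injective h1) (Circle.ext h2)))

/-- The range of a smooth function is a union of three curves, so has Hausdorff dimension at most
one. -/
theorem dense_compl_range {f : C(SpiralSpace, ℂ)} (hf : f ∈ smoothFunctions) :
    Dense (Set.range f)ᶜ := by
  obtain ⟨h1, h2, h3⟩ := hf
  have hsub : Set.range f ⊆ Set.range (fun x => f (ofReal x)) ∪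
      (Set.range (fun t => f (circleTop (Circle.exp t))) ∪
        Set.range (fun t => f (circleBot (Circle.exp t)))) := by
    rintro _ ⟨p, rfl⟩
    induction p using cases_ofReal_circle with
    | h x => exact Or.inl ⟨x, rfl⟩
    | htop z => exact Or.inr (Or.inl ⟨Complex.arg z, by simp [Circle.exp_arg]⟩)
    | hbot z => exact Or.inr (Or.inr ⟨Complex.arg z, by simp [Circle.exp_arg]⟩)
  refine Dense.mono (Set.compl_subset_compl.mpr hsub) (dense_compl_of_dimH_lt_finrank ?_)
  · rw [dimH_union, dimH_union]
    have key : ∀ {g : ℝ → ℂ}, ContDiff ℝ 1 g → dimH (Set.range g) < Module.finrank ℝ ℂ := by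
      intro g hg
      refine hg.dimH_range_le.trans_lt ?_
      rw [Module.finrank_self, Complex.finrank_real_complex]
      norm_num
    exact max_lt (key h1) (max_lt (key h2) (key h3))

/-- The invertible elements of `C(X)` are dense: a smooth approximation of `f` becomes invertible
after the subtraction of a small constant that is not one of its values. -/
theorem dense_isUnit : Dense {f : C(SpiralSpace, ℂ) | IsUnit f} := by
  rw [Metric.dense_iff]
  intro f ε hε
  have hf : f ∈ closure (smoothFunctions : Set C(SpiralSpace, ℂ)) := by
    rw [← StarSubalgebra.topologicalClosure_coe, topologicalClosure_smoothFunctions]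
    trivial
  obtain ⟨g, hg, hfg⟩ := Metric.mem_closure_iff.mp hf (ε / 2) (by positivity)
  obtain ⟨c, hc, hc0⟩ := Metric.dense_iff.mp (dense_compl_range hg) 0 (ε / 2) (by positivity)
  refine ⟨g - algebraMap ℂ _ c, ?_, ?_⟩
  · have h1 : ‖(algebraMap ℂ C(SpiralSpace, ℂ)) c‖ ≤ ‖c‖ :=
      (ContinuousMap.norm_le _ (norm_nonneg c)).mpr fun _ => le_rfl
    rw [mem_ball_zero_iff] at hc
    rw [Metric.mem_ball, dist_eq_norm]
    rw [dist_eq_norm, norm_sub_rev] at hfg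
    calc ‖g - algebraMap ℂ _ c - f‖ = ‖(g - f) - algebraMap ℂ _ c‖ := by congr 1; abel
      _ ≤ ‖g - f‖ + ‖algebraMap ℂ C(SpiralSpace, ℂ) c‖ := norm_sub_le _ _
      _ < ε := by linarith
  · rw [Set.mem_ofPred_eq, ContinuousMap.isUnit_iff_forall_ne_zero]
    intro p hp
    exact hc0 ⟨p, sub_eq_zero.mp hp⟩

end SpiralSpace

namespace CStarK

open Matrix

/-! ### Nowhere vanishing combinations of sections -/

section Sections

variable {X : Type*} [TopologicalSpace X] [CompactSpace X]

/-- If the invertible functions are dense, then two vector-valued functions `s`, `t` have a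
combination `s + y t` without zeros where `s`, `t` are not both small. Where
`s + y t` vanishes for a small `y`, the function `s` is small, so `t` is not, and `-y` is the
coefficient `a = ⟨t, s⟩ / ‖t‖²` of the projection of `s` to `t`; this is excluded by choosing
`a + y` invertible. -/
theorem exists_add_mul_ne_zero (hX : Dense {f : C(X, ℂ) | IsUnit f}) {ι : Type*} [Fintype ι]
    (s t : ι → C(X, ℂ)) {η : ℝ} (hη : 0 < η) :
    ∃ y : C(X, ℂ), ∀ x, η ≤ ∑ i, ‖s i x‖ ^ 2 + ∑ i, ‖t i x‖ ^ 2 →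
      ∃ i, s i x + y x * t i x ≠ 0 := by
  set T : ℝ := ∑ i, ‖t i‖ ^ 2 with hT
  have hT0 : 0 ≤ T := Finset.sum_nonneg fun i _ => sq_nonneg _
  have htT : ∀ x, ∑ i, ‖t i x‖ ^ 2 ≤ T := fun x => by
    refine Finset.sum_le_sum fun i _ => ?_
    gcongr
    exact (t i).norm_coe_le_norm x
  -- With this `ε`, a coefficient of norm at most `ε` makes `y t` of square norm at most `η / 2`.
  set ε : ℝ := √(η / (2 * (T + 1))) with hε
  have hε0 : 0 < ε := Real.sqrt_pos.mpr (by positivity)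
  have hεT : ε ^ 2 * T ≤ η / 2 := by
    rw [hε, Real.sq_sqrt (by positivity), div_mul_eq_mul_div, div_le_div_iff₀ (by positivity)
      (by positivity)]
    nlinarith
  have hmax : ∀ x, ((max (∑ i, ‖t i x‖ ^ 2) (η / 2) : ℝ) : ℂ) ≠ 0 := fun x =>
    Complex.ofReal_ne_zero.mpr (lt_max_of_lt_right (by positivity)).ne'
  -- The maximum in the denominator makes `a` continuous where `t` vanishes.
  let a : C(X, ℂ) := ⟨fun x => (∑ i, star (t i x) * s i x) /
    ((max (∑ i, ‖t i x‖ ^ 2) (η / 2) : ℝ) : ℂ), by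
      refine Continuous.div ?_ ?_ hmax
      · fun_prop
      · fun_prop⟩
  obtain ⟨b, hb, hab⟩ := Metric.dense_iff.mp hX a ε hε0
  refine ⟨b - a, fun x hx => ?_⟩
  by_contra! H
  have hs : ∀ i, s i x = -((b - a) x * t i x) := fun i => eq_neg_of_add_eq_zero_left (H i)
  have hy : ‖(b - a) x‖ ≤ ε :=
    ((b - a).norm_coe_le_norm x).trans (by rw [← dist_eq_norm]; exact hb.le)
  have hs2 : ∑ i, ‖s i x‖ ^ 2 ≤ η / 2 := by
    calc ∑ i, ‖s i x‖ ^ 2 = ‖(b - a) x‖ ^ 2 * ∑ i, ‖t i x‖ ^ 2 := by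
          rw [Finset.mul_sum]
          exact Finset.sum_congr rfl fun i _ => by rw [hs i, norm_neg, norm_mul, mul_pow]
      _ ≤ ε ^ 2 * T := by gcongr; exact htT x
      _ ≤ η / 2 := hεT
  have ht2 : η / 2 ≤ ∑ i, ‖t i x‖ ^ 2 := by linarith
  have hf : ∑ i, star (t i x) * s i x = -((b - a) x) * ((∑ i, ‖t i x‖ ^ 2 : ℝ) : ℂ) := by
    rw [Complex.ofReal_sum, Finset.mul_sum]
    refine Finset.sum_congr rfl fun i _ => ?_
    rw [hs i, Complex.ofReal_pow, ← Complex.conj_mul', Complex.star_def, mul_neg, neg_mul,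
      mul_left_comm]
  have ha : a x = -((b - a) x) := by
    change (∑ i, star (t i x) * s i x) / ((max (∑ i, ‖t i x‖ ^ 2) (η / 2) : ℝ) : ℂ) = _
    have := hmax x
    rw [max_eq_left ht2] at this ⊢
    rw [hf, mul_div_cancel_right₀ _ this]
  refine (ContinuousMap.isUnit_iff_forall_ne_zero b).mp hab x ?_
  rw [ContinuousMap.sub_apply] at ha
  linear_combination ha

/-- If the invertible functions are dense, then finitely many vector-valued functions have
a combination without zeros where they are not all small. -/
theorem exists_sum_mul_ne_zero_of_le (hX : Dense {f : C(X, ℂ) | IsUnit f}) {ι κ : Type*}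
    [Fintype ι] (J : Finset κ) (s : κ → ι → C(X, ℂ)) {η : ℝ} (hη : 0 < η) :
    ∃ c : κ → C(X, ℂ), ∀ x, η ≤ ∑ j ∈ J, ∑ i, ‖s j i x‖ ^ 2 →
      ∃ i, ∑ j ∈ J, c j x * s j i x ≠ 0 := by
  classical
  induction J using Finset.induction_on generalizing η with
  | empty => exact ⟨0, fun x hx => absurd hx (by simpa using hη)⟩
  | insert k J hk ih =>
    obtain ⟨c, hc⟩ := ih (half_pos hη)
    let t : ι → C(X, ℂ) := fun i => ∑ j ∈ J, c j * s j i
    have ht : ∀ i x, t i x = ∑ j ∈ J, c j x * s j i x := fun i x => by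
      simp [t, ContinuousMap.sum_apply]
    -- By compactness `t` is bounded away from zero where it is known not to vanish.
    obtain ⟨δ, hδ, hδt⟩ : ∃ δ > 0, ∀ x, η / 2 ≤ ∑ j ∈ J, ∑ i, ‖s j i x‖ ^ 2 →
        δ ≤ ∑ i, ‖t i x‖ ^ 2 := by
      have hK : IsCompact {x | η / 2 ≤ ∑ j ∈ J, ∑ i, ‖s j i x‖ ^ 2} :=
        (isClosed_le continuous_const (by fun_prop)).isCompact
      obtain ⟨δ, hδ, h⟩ := hK.exists_forall_le' (f := fun x => ∑ i, ‖t i x‖ ^ 2)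
        (a := 0) (Continuous.continuousOn (by fun_prop)) fun x hx => by
          obtain ⟨i, hi⟩ := hc x hx
          rw [← ht] at hi
          exact Finset.sum_pos' (fun _ _ => sq_nonneg _)
            ⟨i, Finset.mem_univ i, by positivity⟩
      exact ⟨δ, hδ, h⟩
    obtain ⟨y, hy⟩ := exists_add_mul_ne_zero hX (s k) t (lt_min (half_pos hη) hδ)
    refine ⟨Function.update (fun j => y * c j) k 1, fun x hx => ?_⟩
    rw [Finset.sum_insert hk] at hx
    have hsum : ∀ i, ∑ j ∈ insert k J, Function.update (fun j => y * c j) k 1 j x * s j i x =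
        s k i x + y x * t i x := fun i => by
      rw [Finset.sum_insert hk, Function.update_self, ht, Finset.mul_sum]
      congr 1
      · simp
      · refine Finset.sum_congr rfl fun j hj => ?_
        rw [Function.update_of_ne (ne_of_mem_of_not_mem hj hk), ContinuousMap.mul_apply,
          mul_assoc]
    simp only [hsum]
    apply hy
    have h1 : 0 ≤ ∑ i, ‖s k i x‖ ^ 2 := Finset.sum_nonneg fun i _ => sq_nonneg _
    have h2 : 0 ≤ ∑ i, ‖t i x‖ ^ 2 := Finset.sum_nonneg fun i _ => sq_nonneg _
    rcases le_or_gt (η / 2) (∑ j ∈ J, ∑ i, ‖s j i x‖ ^ 2) with h | h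
    · exact (min_le_right _ _).trans (by linarith [hδt x h])
    · exact (min_le_left _ _).trans (by linarith)

/-- If the invertible functions are dense, then a matrix of functions that has no zero maps some
vector of functions to a vector of functions that has no zero. -/
theorem exists_mulVec_ne_zero (hX : Dense {f : C(X, ℂ) | IsUnit f}) {ι κ : Type*}
    [Fintype ι] [Fintype κ] (p : Matrix ι κ C(X, ℂ)) (hp : ∀ x, ∃ i j, p i j x ≠ 0) :
    ∃ c : κ → C(X, ℂ), ∀ x, ∃ i, (p *ᵥ c) i x ≠ 0 := by
  obtain ⟨η, hη, h⟩ := (isCompact_univ (X := X)).exists_forall_le'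
    (f := fun x => ∑ j, ∑ i, ‖p i j x‖ ^ 2) (a := 0) (Continuous.continuousOn (by fun_prop))
    fun x _ => by
      obtain ⟨i, j, hij⟩ := hp x
      exact Finset.sum_pos' (fun _ _ => Finset.sum_nonneg fun _ _ => sq_nonneg _)
        ⟨j, Finset.mem_univ j, Finset.sum_pos' (fun _ _ => sq_nonneg _)
          ⟨i, Finset.mem_univ i, by positivity⟩⟩
  obtain ⟨c, hc⟩ := exists_sum_mul_ne_zero_of_le hX Finset.univ (fun j i => p i j) hη
  refine ⟨c, fun x => ?_⟩
  obtain ⟨i, hi⟩ := hc x (h x trivial)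
  refine ⟨i, ?_⟩
  simpa [Matrix.mulVec, dotProduct, ContinuousMap.sum_apply, mul_comm] using hi

/-- A projection over `C(X)` without zeros fixes a vector of length one. -/
theorem exists_unit_vector (hX : Dense {f : C(X, ℂ) | IsUnit f}) {ι : Type*} [Fintype ι]
    {p : Matrix ι ι C(X, ℂ)} (hp : p * p = p) (hp0 : ∀ x, ∃ i j, p i j x ≠ 0) :
    ∃ v : ι → C(X, ℂ), p *ᵥ v = v ∧ star v ⬝ᵥ v = 1 := by
  obtain ⟨c, hc⟩ := exists_mulVec_ne_zero hX p hp0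
  have hpos : ∀ x, 0 < ∑ i, ‖(p *ᵥ c) i x‖ ^ 2 := fun x => by
    obtain ⟨i, hi⟩ := hc x
    exact Finset.sum_pos' (fun _ _ => sq_nonneg _) ⟨i, Finset.mem_univ i, by positivity⟩
  let r : C(X, ℂ) := ⟨fun x => ((√(∑ i, ‖(p *ᵥ c) i x‖ ^ 2))⁻¹ : ℝ), by
    refine Complex.continuous_ofReal.comp (Continuous.inv₀ (by fun_prop) fun x => ?_)
    exact (Real.sqrt_pos.mpr (hpos x)).ne'⟩
  refine ⟨r • (p *ᵥ c), ?_, ?_⟩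
  · rw [Matrix.mulVec_smul, Matrix.mulVec_mulVec, hp]
  · ext x
    have hr : star (r x) = r x := Complex.conj_ofReal _
    have h1 : (star (r • (p *ᵥ c)) ⬝ᵥ (r • (p *ᵥ c))) x =
        r x * r x * ((∑ i, ‖(p *ᵥ c) i x‖ ^ 2 : ℝ) : ℂ) := by
      simp only [dotProduct, ContinuousMap.sum_apply, Pi.star_apply, Pi.smul_apply, smul_eq_mul,
        ContinuousMap.mul_apply, ContinuousMap.star_apply, star_mul, hr, Complex.ofReal_sum,
        Complex.ofReal_pow, Finset.mul_sum]
      refine Finset.sum_congr rfl fun i _ => ?_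
      rw [← Complex.conj_mul', Complex.star_def]
      ring
    rw [h1, ContinuousMap.one_apply]
    change (((√(∑ i, ‖(p *ᵥ c) i x‖ ^ 2))⁻¹ : ℝ) : ℂ) *
      (((√(∑ i, ‖(p *ᵥ c) i x‖ ^ 2))⁻¹ : ℝ) : ℂ) * _ = 1
    rw [← Complex.ofReal_mul, ← Complex.ofReal_mul, ← mul_inv, Real.mul_self_sqrt (hpos x).le,
      inv_mul_cancel₀ (hpos x).ne', Complex.ofReal_one]

end Sections

/-! ### The group `K₀` -/

theorem grothendieckAddGroup_mk_eq_sub {M : Type*} [AddCommMonoid M] (a b : M)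
    (hb : b ∈ (⊤ : AddSubmonoid M)) : AddLocalization.mk a ⟨b, hb⟩ =
      Algebra.GrothendieckAddGroup.of a - Algebra.GrothendieckAddGroup.of b := by
  simp only [Algebra.GrothendieckAddGroup.of, AddSubmonoid.LocalizationMap.toAddMonoidHom_apply,
    ← AddLocalization.mk_zero_eq_addMonoidOf_mk]
  rw [Algebra.GrothendieckAddGroup.mk_sub_mk]
  simp

section Rank

variable {A : Type*} [CommCStarAlgebra A]

theorem trace_dsum {m n : ℕ} (p : Matrix (Fin m) (Fin m) A) (q : Matrix (Fin n) (Fin n) A) :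
    (dsum p q).trace = p.trace + q.trace := by
  simp only [Matrix.trace, dsum, Matrix.diag_apply, Matrix.submatrix_apply]
  rw [finSumFinEquiv.symm.sum_comp fun i => fromBlocks p 0 0 q i i, Fintype.sum_sum_type]
  rfl

theorem MvN.trace_eq {ι κ : Type} [Fintype ι] [Fintype κ] {p : Matrix ι ι A} {q : Matrix κ κ A}
    (h : MvN p q) : p.trace = q.trace := by
  obtain ⟨v, rfl, rfl⟩ := h
  exact Matrix.trace_mul_comm _ _

/-- The trace of projections, as a homomorphism to the additive group of a commutative
C⋆-algebra. -/
def traceHom (A : Type*) [CommCStarAlgebra A] : KZero A →+ A :=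
  Algebra.GrothendieckAddGroup.lift
    { toFun := Quotient.lift (fun p : MatProj A => p.mat.trace) fun _ _ h => MvN.trace_eq h
      map_zero' := Matrix.trace_fin_zero _
      map_add' := by
        rintro ⟨p⟩ ⟨q⟩
        exact trace_dsum p.mat q.mat }

theorem traceHom_of (p : MatProj A) :
    traceHom A (Algebra.GrothendieckAddGroup.of (ProjClass.mk p)) = p.mat.trace :=
  DFunLike.congr_fun (Algebra.GrothendieckAddGroup.lift.symm_apply_apply _) _

theorem traceHom_classZero (p : A) (hp : IsStarProjection p) : traceHom A (classZero p hp) = p := by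
  refine (traceHom_of _).trans ?_
  simp [Matrix.trace]

/-- A projection that fixes a vector of length one splits off a trivial summand of rank one. -/
theorem exists_mvN_dsum_one {n : ℕ} {p : Matrix (Fin n) (Fin n) A} (hp : IsStarProjection p)
    {v : Fin n → A} (hpv : p *ᵥ v = v) (hv : star v ⬝ᵥ v = 1) :
    ∃ q : Matrix (Fin n) (Fin n) A, IsStarProjection q ∧
      MvN p (dsum (diagonal fun _ : Fin 1 => (1 : A)) q) := by
  have h1 : pᴴ = p := hp.isSelfAdjoint
  have h2 : p * p = p := hp.isIdempotentElem
  set e : Matrix (Fin n) (Fin n) A := vecMulVec v (star v) with he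
  have hee : e * e = e := by
    rw [he, vecMulVec_mul_vecMulVec, hv, one_smul]
  have hes : eᴴ = e := by
    rw [he, conjTranspose_vecMulVec, star_star]
  have hpe : p * e = e := by
    rw [he, mul_vecMulVec, hpv]
  have hep : e * p = e := by
    rw [← hes, ← h1, ← conjTranspose_mul, hpe]
  have hqs : (p - e)ᴴ = p - e := by rw [conjTranspose_sub, h1, hes]
  have hqq : (p - e) * (p - e) = p - e := by
    rw [sub_mul, mul_sub, mul_sub, h2, hpe, hep, hee]
    abel
  have hq : IsStarProjection (p - e) := ⟨hqq, hqs⟩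
  refine ⟨p - e, hq, MvN.trans hp ?_ ?_ (mvN_submatrix ?_ _)⟩
  · exact isStarProjection_dsum (isStarProjection_oneByOne (IsStarProjection.one _)) hq
  · have hqv : (p - e) *ᵥ v = 0 := by
      rw [sub_mulVec, hpv, he, vecMulVec_mulVec, hv]
      simp
    have hvq : star v ᵥ* (p - e) = 0 := by
      rw [← hqs, ← star_mulVec, hqv, star_zero]
    -- The partial isometry with the rows `v⋆` and `p - v v⋆`.
    refine ⟨fromRows (replicateRow (Fin 1) (star v)) (p - e), ?_, ?_⟩
    · rw [conjTranspose_fromRows_eq_fromCols_conjTranspose, fromCols_mul_fromRows, hqs, hqq,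
        conjTranspose_replicateRow, star_star]
      exact (congrArg (· + (p - e)) (vecMulVec_eq (Fin 1) v (star v)).symm).trans
        (add_sub_cancel e p)
    · rw [conjTranspose_fromRows_eq_fromCols_conjTranspose, fromRows_mul_fromCols, hqs, hqq,
        conjTranspose_replicateRow, star_star]
      congr 1
      · ext i j
        simp [Subsingleton.elim i j, ← hv, Matrix.mul_apply, dotProduct]
      · ext i j
        simpa [Matrix.mul_apply, vecMul, dotProduct] using congrFun hvq j
      · ext i j
        simpa [Matrix.mul_apply, mulVec, dotProduct] using congrFun hqv i
  · exact isStarProjection_fromBlocks (isStarProjection_oneByOne (IsStarProjection.one _)) hq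

end Rank

section KZeroFunctions

variable {X : Type*} [TopologicalSpace X]

/-- A projection vanishes where its trace does, as its trace is the sum of the squares of the
absolute values of its entries. -/
theorem eq_zero_of_trace_apply_eq_zero {ι : Type*} [Fintype ι] {p : Matrix ι ι C(X, ℂ)}
    (hp : IsStarProjection p) {x : X} (hx : p.trace x = 0) (i j : ι) : p i j x = 0 := by
  have h1 : pᴴ = p := hp.isSelfAdjoint
  have h2 : p * p = p := hp.isIdempotentElem
  have key : p.trace x = ((∑ i, ∑ j, ‖p i j x‖ ^ 2 : ℝ) : ℂ) := by
    have : p.trace = (p * pᴴ).trace := by rw [h1, h2]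
    rw [this]
    simp only [Matrix.trace, Matrix.diag_apply, Matrix.mul_apply, ContinuousMap.sum_apply,
      conjTranspose_apply, ContinuousMap.mul_apply, ContinuousMap.star_apply, Complex.star_def,
      Complex.mul_conj']
    push_cast
    rfl
  rw [key, Complex.ofReal_eq_zero, Finset.sum_eq_zero_iff_of_nonneg fun _ _ =>
    Finset.sum_nonneg fun _ _ => sq_nonneg _] at hx
  have h3 := hx i (Finset.mem_univ i)
  rw [Finset.sum_eq_zero_iff_of_nonneg fun _ _ => sq_nonneg _] at h3
  simpa using h3 j (Finset.mem_univ j)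

/-- The trace of a projection at a point is the rank there. -/
theorem trace_apply_mem_range_natCast {ι : Type*} [Fintype ι] [DecidableEq ι]
    {p : Matrix ι ι C(X, ℂ)} (hp : IsStarProjection p) (x : X) :
    p.trace x ∈ Set.range (Nat.cast : ℕ → ℂ) := by
  have h2 : p * p = p := hp.isIdempotentElem
  let ev : C(X, ℂ) →+* ℂ := ⟨⟨⟨fun f => f x, rfl⟩, fun _ _ => rfl⟩, rfl, fun _ _ => rfl⟩
  have h3 : IsIdempotentElem (toLin' (p.map ev)) := by
    rw [IsIdempotentElem, Module.End.mul_eq_comp, ← toLin'_mul, ← Matrix.map_mul, h2]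
  refine ⟨_, ((LinearMap.IsIdempotentElem.isProj_range _ h3).trace).symm.trans ?_⟩
  rw [Matrix.trace_toLin'_eq]
  exact (AddMonoidHom.map_trace ev.toAddMonoidHom p).symm

/-- The rank of a projection is constant on a connected space. -/
theorem exists_trace_eq_natCast [PreconnectedSpace X] [Nonempty X] {ι : Type*}
    [Fintype ι] [DecidableEq ι] {p : Matrix ι ι C(X, ℂ)} (hp : IsStarProjection p) :
    ∃ k : ℕ, p.trace = k := by
  obtain ⟨x₀⟩ := ‹Nonempty X›
  obtain ⟨k, hk⟩ := trace_apply_mem_range_natCast hp x₀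
  refine ⟨k, ContinuousMap.ext fun x => ?_⟩
  have hconst := (isPreconnected_univ (α := X)).constant_of_mapsTo
    (T := Set.range (Nat.cast : ℕ → ℂ)) (f := p.trace)
    (Complex.isometry_ofReal.isEmbedding.comp
      Nat.isClosedEmbedding_coe_real.isEmbedding).isDiscrete_range
    (ContinuousMap.continuous _).continuousOn
    (fun x _ => trace_apply_mem_range_natCast hp x) (Set.mem_univ x) (Set.mem_univ x₀)
  rw [hconst, ← hk, ContinuousMap.natCast_apply]

/-- If the invertible functions on a connected space are dense, then every projection over `C(X)`
is trivial up to equivalence. -/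
theorem of_mk_eq_nsmul [CompactSpace X] (hX : Dense {f : C(X, ℂ) | IsUnit f}) (k : ℕ) :
    ∀ p : MatProj C(X, ℂ), p.mat.trace = k →
      Algebra.GrothendieckAddGroup.of (ProjClass.mk p) =
        k • classZero (1 : C(X, ℂ)) (IsStarProjection.one _) := by
  induction k with
  | zero =>
    intro p hp
    have h0 : p.mat = 0 := by
      ext i j x
      exact eq_zero_of_trace_apply_eq_zero p.isProj (by rw [hp]; simp) i j
    have : ProjClass.mk p = 0 := by
      refine Quotient.sound (s := MatProj.setoid _) ?_
      refine ⟨(0 : Matrix (Fin 0) (Fin p.size) C(X, ℂ)), ?_, ?_⟩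
      · rw [h0, Matrix.mul_zero]
      · rw [Matrix.zero_mul]
    rw [this, map_zero, zero_smul]
  | succ k ih =>
    intro p hp
    have hp0 : ∀ x, ∃ i j, p.mat i j x ≠ 0 := by
      intro x
      by_contra! H
      have h1 : p.mat.trace x = 0 := by
        simp only [Matrix.trace, ContinuousMap.sum_apply, Matrix.diag_apply, H,
          Finset.sum_const_zero]
      rw [hp] at h1
      exact Nat.cast_add_one_ne_zero (R := ℂ) k (by simpa using h1)
    obtain ⟨v, hpv, hv⟩ := exists_unit_vector hX p.isProj.isIdempotentElem hp0
    obtain ⟨q, hq, hpq⟩ := exists_mvN_dsum_one p.isProj hpv hv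
    have htr : q.trace = k := by
      have := hpq.trace_eq
      rw [trace_dsum, hp] at this
      simp only [Matrix.trace_diagonal, Finset.univ_unique, Finset.sum_singleton] at this
      push_cast at this
      linear_combination -this
    have hsum : ProjClass.mk p = ProjClass.mk
        ⟨1, _, isStarProjection_oneByOne (IsStarProjection.one C(X, ℂ))⟩ +
          ProjClass.mk ⟨p.size, q, hq⟩ :=
      Quotient.sound (s := MatProj.setoid _) hpq
    rw [hsum, map_add, ih ⟨p.size, q, hq⟩ htr, succ_nsmul', classZero]

/-- `K₀(C(X))` is infinite cyclic with generator `[1]₀`, for a connected compact space `X` on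
which the invertible functions are dense. -/
theorem bijective_zsmul_classZero_one [PreconnectedSpace X] [Nonempty X]
    [CompactSpace X] (hX : Dense {f : C(X, ℂ) | IsUnit f}) :
    Function.Bijective fun n : ℤ => n • classZero (1 : C(X, ℂ)) (IsStarProjection.one _) := by
  constructor
  · intro m n h
    have h1 := congrArg (traceHom C(X, ℂ)) h
    simp only [map_zsmul, traceHom_classZero] at h1
    obtain ⟨x⟩ := ‹Nonempty X›
    simpa using DFunLike.congr_fun h1 x
  · intro z
    induction z using AddLocalization.ind with
    | H y =>
      obtain ⟨⟨a⟩, ⟨⟨b⟩, hb⟩⟩ := y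
      obtain ⟨k, hk⟩ := exists_trace_eq_natCast a.isProj
      obtain ⟨l, hl⟩ := exists_trace_eq_natCast b.isProj
      refine ⟨k - l, ?_⟩
      have ha' := of_mk_eq_nsmul hX k a hk
      have hb' := of_mk_eq_nsmul hX l b hl
      simp only [sub_smul, natCast_zsmul, ← ha', ← hb']
      exact (grothendieckAddGroup_mk_eq_sub _ _ hb).symm

end KZeroFunctions

/-! ### Polar decomposition -/

section Polar

variable {B : Type*} [CStarAlgebra B] [PartialOrder B] [StarOrderedRing B]

theorem isUnit_cfcAbs {g : B} (hg : IsUnit g) : IsUnit (CFC.abs g) := by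
  have h : IsUnit (CFC.abs g * CFC.abs g) := by
    rw [CFC.abs_mul_abs]
    exact hg.star.mul hg
  exact ((Commute.refl _).isUnit_mul_iff.mp h).1

/-- The unitary part `g |g|⁻¹` of the polar decomposition of an invertible element `g`. -/
def polarPart (g : B) : B := g * Ring.inverse (CFC.abs g)

theorem polarPart_mul_abs {g : B} (hg : IsUnit g) : polarPart g * CFC.abs g = g := by
  rw [polarPart, mul_assoc, Ring.inverse_mul_cancel _ (isUnit_cfcAbs hg), mul_one]

theorem polarPart_mem {g : B} (hg : IsUnit g) : polarPart g ∈ unitary B := by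
  have ha := isUnit_cfcAbs hg
  have h1 : star (polarPart g) * polarPart g = 1 := by
    have hs : star (CFC.abs g) = CFC.abs g := (CFC.abs_nonneg g).isSelfAdjoint
    refine ha.mul_left_cancel (ha.mul_right_cancel ?_)
    calc CFC.abs g * (star (polarPart g) * polarPart g) * CFC.abs g
        = star (polarPart g * CFC.abs g) * (polarPart g * CFC.abs g) := by
          rw [star_mul, hs]
          simp only [mul_assoc]
      _ = CFC.abs g * 1 * CFC.abs g := by rw [polarPart_mul_abs hg, mul_one, CFC.abs_mul_abs]
  have h2 : IsUnit (polarPart g) := hg.mul ha.ringInverse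
  exact ⟨h1, h2.mul_right_cancel (by rw [mul_assoc, h1, mul_one, one_mul])⟩

theorem polarPart_of_mem {u : B} (hu : u ∈ unitary B) : polarPart u = u := by
  have h : CFC.abs u = 1 := by
    rw [CFC.abs, Unitary.star_mul_self_of_mem hu, CFC.sqrt_one]
  rw [polarPart, h, Ring.inverse_one, mul_one]

theorem continuousOn_polarPart : ContinuousOn (polarPart : B → B) {g | IsUnit g} := by
  intro g hg
  obtain ⟨a, ha⟩ := isUnit_cfcAbs hg
  have h : ContinuousAt Ring.inverse (CFC.abs g) := by
    rw [← ha]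
    exact NormedRing.inverse_continuousAt a
  have habs : Continuous (CFC.abs : B → B) := CFC.continuous_abs
  exact (continuousAt_id.mul (h.comp habs.continuousAt)).continuousWithinAt

/-- An invertible element is joined to the unitary part of its polar decomposition. -/
theorem joinedIn_polarPart {g : B} (hg : IsUnit g) :
    JoinedIn {g : B | IsUnit g} g (polarPart g) := by
  refine JoinedIn.ofLine (f := fun t : ℝ => polarPart g * ((1 - t) • CFC.abs g + t • 1))
    (by fun_prop) ?_ (by simp) ?_
  · simp [polarPart_mul_abs hg]
  · rintro _ ⟨t, ⟨h0, h1⟩, rfl⟩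
    refine (hg.mul (isUnit_cfcAbs hg).ringInverse).mul ?_
    rcases h0.eq_or_lt with rfl | h0
    · simpa using isUnit_cfcAbs hg
    · have : IsStrictlyPositive (t • (1 : B)) := isStrictlyPositive_one.smul h0
      exact (this.nonneg_add (smul_nonneg (by linarith) (CFC.abs_nonneg g))).isUnit

end Polar

section MatrixUnits

variable {A : Type*} [CStarAlgebra A]

theorem isOpen_isUnit_matrix (n : ℕ) : IsOpen {g : Matrix (Fin n) (Fin n) A | IsUnit g} := by
  let := CStarAlgebra.spectralOrder A
  let := CStarAlgebra.spectralOrderedRing A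
  let e := CStarMatrix.ofMatrixStarAlgEquiv (n := Fin n) (A := A)
  have he : Continuous e := (isHomeomorph_ofMatrix A n).continuous
  convert! (Units.isOpen (R := CStarMatrix (Fin n) (Fin n) A)).preimage he using 1

/-- Every invertible matrix can be joined to a unitary matrix by a path of invertible matrices. -/
theorem exists_joinedIn_unitary {n : ℕ} {g : Matrix (Fin n) (Fin n) A} (hg : IsUnit g) :
    ∃ w : UMat A n, JoinedIn {g : Matrix (Fin n) (Fin n) A | IsUnit g} g w := by
  let := CStarAlgebra.spectralOrder A
  let := CStarAlgebra.spectralOrderedRing A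
  let := CStarAlgebra.spectralOrder (CStarMatrix (Fin n) (Fin n) A)
  let := CStarAlgebra.spectralOrderedRing (CStarMatrix (Fin n) (Fin n) A)
  let e := CStarMatrix.ofMatrixStarAlgEquiv (n := Fin n) (A := A)
  have he : Continuous e.symm :=
    (CStarMatrix.ofMatrixL (m := Fin n) (n := Fin n) (A := A)).symm.continuous
  have hg' : IsUnit (e g) := hg.map e
  refine ⟨⟨e.symm (polarPart (e g)), Unitary.map_mem e.symm (polarPart_mem hg')⟩, ?_⟩
  obtain ⟨γ, hγ⟩ := joinedIn_polarPart hg'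
  exact ⟨(γ.map he).cast (e.symm_apply_apply g).symm rfl, fun t => (hγ t).map e.symm⟩

/-- Unitary matrices that are joined by a path of invertible matrices are joined by a path of
unitary matrices. -/
theorem joined_of_joinedIn_isUnit {n : ℕ} {u v : UMat A n}
    (h : JoinedIn {g : Matrix (Fin n) (Fin n) A | IsUnit g} u v) : Joined u v := by
  let := CStarAlgebra.spectralOrder A
  let := CStarAlgebra.spectralOrderedRing A
  let := CStarAlgebra.spectralOrder (CStarMatrix (Fin n) (Fin n) A)
  let := CStarAlgebra.spectralOrderedRing (CStarMatrix (Fin n) (Fin n) A)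
  let e := CStarMatrix.ofMatrixStarAlgEquiv (n := Fin n) (A := A)
  have he : Continuous e := (isHomeomorph_ofMatrix A n).continuous
  have he' : Continuous e.symm :=
    (CStarMatrix.ofMatrixL (m := Fin n) (n := Fin n) (A := A)).symm.continuous
  obtain ⟨γ, hγ⟩ := h
  have hγ' : ∀ t, IsUnit (e (γ t)) := fun t => (hγ t).map e
  have hfix : ∀ w : UMat A n, e.symm (polarPart (e w.1)) = w.1 := fun w => by
    rw [polarPart_of_mem (Unitary.map_mem e w.2), e.symm_apply_apply]
  refine ⟨⟨⟨fun t => ⟨e.symm (polarPart (e (γ t))),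
    Unitary.map_mem e.symm (polarPart_mem (hγ' t))⟩, ?_⟩, ?_, ?_⟩⟩
  · exact (he'.comp
      (continuousOn_polarPart.comp_continuous (he.comp γ.continuous) hγ')).subtype_mk _
  · exact Subtype.ext ((congrArg (fun g => e.symm (polarPart (e g))) γ.source).trans (hfix u))
  · exact Subtype.ext ((congrArg (fun g => e.symm (polarPart (e g))) γ.target).trans (hfix v))

end MatrixUnits

/-! ### Reduction of unitary matrices to unitary functions -/

section ClassU

variable {A : Type*} [CStarAlgebra A]

/-- The class in `K₁(A)` of a unitary matrix over `A`. -/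
def classU {n : ℕ} (u : UMat A n) : KOne A :=
  Additive.ofMul (QuotientGroup.mk (UInfty.mk u))

theorem classU_mul {n : ℕ} (u v : UMat A n) : classU (u * v) = classU u + classU v := by
  rw [classU, UInfty.mk_mul]
  rfl

theorem classU_one (n : ℕ) : classU (1 : UMat A n) = 0 := by
  rw [classU, UInfty.mk_one]
  rfl

theorem classU_inv {n : ℕ} (u : UMat A n) : classU u⁻¹ = -classU u := rfl

theorem classU_padHom {n m : ℕ} (h : n ≤ m) (u : UMat A n) :
    classU (padHom A n m h u) = classU u := by
  rw [classU, UInfty.mk_pad, classU]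

theorem classU_eq_zero_of_joined {n : ℕ} {u : UMat A n} (h : Joined 1 u) : classU u = 0 :=
  (QuotientGroup.eq_one_iff _).mpr ⟨n, u, h, rfl⟩

theorem classU_eq_of_joined {n : ℕ} {u v : UMat A n} (h : Joined u v) : classU u = classU v := by
  have h1 : Joined 1 (u⁻¹ * v) := by simpa using (Joined.refl u⁻¹).mul h
  have h2 := classU_eq_zero_of_joined h1
  rw [classU_mul, classU_inv] at h2
  exact (neg_add_eq_zero.mp h2)

theorem surjective_classU (z : KOne A) : ∃ (n : ℕ) (u : UMat A n), classU u = z := by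
  obtain ⟨x, rfl⟩ := QuotientGroup.mk_surjective z.toMul
  obtain ⟨n, u, rfl⟩ := DirectLimit.exists_eq_mk (padHom A) x
  exact ⟨n, u, rfl⟩

theorem oneByOne_mul (u v : unitary A) : oneByOne (u * v) = oneByOne u * oneByOne v :=
  Subtype.ext (diagonal_mul_diagonal _ _).symm

/-- The class of a unitary element, as a homomorphism. -/
def classOneHom (A : Type*) [CStarAlgebra A] : Additive (unitary A) →+ KOne A :=
  AddMonoidHom.mk' (fun u => classOne u.toMul) fun u v => by
    change classU (oneByOne (u.toMul * v.toMul)) = _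
    rw [oneByOne_mul, classU_mul]
    rfl

theorem classOne_mul (u v : unitary A) : classOne (u * v) = classOne u + classOne v :=
  (classOneHom A).map_add (Additive.ofMul u) (Additive.ofMul v)

theorem classOne_zpow (u : unitary A) (n : ℤ) : classOne (u ^ n) = n • classOne u :=
  (classOneHom A).map_zsmul n (Additive.ofMul u)

theorem continuous_oneByOne : Continuous (oneByOne : unitary A → UMat A 1) :=
  (Continuous.matrix_diagonal (continuous_pi fun _ => continuous_subtype_val)).subtype_mk _

theorem classOne_eq_zero_of_joined {u : unitary A} (h : Joined 1 u) : classOne u = 0 := by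
  refine classU_eq_zero_of_joined ?_
  have h1 := h.map continuous_oneByOne
  have h2 : oneByOne (1 : unitary A) = 1 := Subtype.ext diagonal_one
  rwa [h2] at h1

/-- The permutation matrix of `σ`. -/
def permU (A : Type*) [CStarAlgebra A] {n : ℕ} (σ : Equiv.Perm (Fin n)) : UMat A n :=
  ⟨(1 : Matrix (Fin n) (Fin n) A).submatrix σ id, by
    rw [Unitary.mem_iff, star_eq_conjTranspose, conjTranspose_submatrix, conjTranspose_one]
    constructor
    · rw [submatrix_mul_equiv, mul_one, submatrix_id_id]
    · rw [← submatrix_mul _ _ σ id σ Function.bijective_id, mul_one, submatrix_one_equiv]⟩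

/-- A permutation of the basis does not change the class of a unitary matrix, since `K₁` is
abelian. -/
theorem classU_eq_of_submatrix {n : ℕ} (σ : Equiv.Perm (Fin n)) {u v : UMat A n}
    (h : v.1 = u.1.submatrix σ σ) : classU v = classU u := by
  have h1 : v = permU A σ * u * (permU A σ)⁻¹ := by
    apply Subtype.ext
    change v.1 = (1 : Matrix (Fin n) (Fin n) A).submatrix σ id * u.1 *
      star ((1 : Matrix (Fin n) (Fin n) A).submatrix σ id)
    rw [star_eq_conjTranspose, conjTranspose_submatrix, conjTranspose_one, h]
    nth_rw 2 [← submatrix_id_id u.1]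
    rw [← submatrix_mul _ _ _ _ _ Function.bijective_id,
      ← submatrix_mul _ _ _ _ _ Function.bijective_id, one_mul, mul_one]
  rw [h1, classU_mul, classU_mul, classU_inv]
  abel

/-- The direct sum of unitary matrices. -/
def dsumU {m n : ℕ} (u : UMat A m) (v : UMat A n) : UMat A (m + n) :=
  ⟨dsum u.1 v.1, by
    have h1 := Unitary.mem_iff.mp u.2
    have h2 := Unitary.mem_iff.mp v.2
    rw [star_eq_conjTranspose] at h1 h2
    rw [Unitary.mem_iff, star_eq_conjTranspose]
    simp [dsum, conjTranspose_submatrix, fromBlocks_conjTranspose, submatrix_mul_equiv,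
      fromBlocks_multiply, h1, h2]⟩

theorem classU_dsumU_one {n : ℕ} (a : UMat A 1) : classU (dsumU (1 : UMat A n) a) = classU a := by
  rw [← classU_padHom (Nat.le_add_left 1 n) a]
  refine classU_eq_of_submatrix (Equiv.swap 0 (Fin.last n)) ?_
  change dsum 1 a.1 = (pad (n + 1) a.1).submatrix _ _
  have h1 : dsum (1 : Matrix (Fin n) (Fin n) A) a.1 =
      diagonal (Function.update (fun _ => 1) (Fin.last n) (a.1 0 0)) := by
    ext i j
    refine Fin.addCases (fun i => ?_) (fun i => ?_) i <;>
      refine Fin.addCases (fun j => ?_) (fun j => ?_) j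
    · have h3 : Fin.castAdd 1 i ≠ Fin.last n := (Fin.castSucc_lt_last i).ne
      simp [dsum, diagonal_apply, one_apply, Function.update_of_ne h3]
    · have h3 : Fin.castAdd 1 i ≠ Fin.natAdd n j := fun h => by
        have := congrArg Fin.val h
        simp at this
        omega
      simp [dsum, h3]
    · have h3 : Fin.natAdd n i ≠ Fin.castAdd 1 j := fun h => by
        have := congrArg Fin.val h
        simp at this
        omega
      simp [dsum, h3]
    · have h3 : Fin.natAdd n (0 : Fin 1) = Fin.last n := rfl
      rw [Subsingleton.elim i 0, Subsingleton.elim j 0, h3, diagonal_apply_eq, Function.update_self,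
        ← h3]
      simp [dsum, -Fin.natAdd_eq_addNat]
  have h2 : pad (n + 1) a.1 = diagonal (Function.update (fun _ => 1) 0 (a.1 0 0)) := by
    ext i j
    simp only [pad, diagonal_apply, Nat.lt_one_iff, Fin.val_eq_zero_iff]
    by_cases hi : i = 0
    · by_cases hj : j = 0
      · simp [hi, hj]
      · simp [hi, hj, Ne.symm hj]
    · simp [hi]
  rw [h1, h2, submatrix_diagonal_equiv, Function.update_comp_equiv, Equiv.symm_swap,
    Equiv.swap_apply_left]
  rfl

theorem classU_dsumU {n : ℕ} (s : UMat A n) (a : UMat A 1) :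
    classU (dsumU s a) = classU s + classU a := by
  have h : dsumU s a = padHom A n (n + 1) (Nat.le_add_right n 1) s * dsumU 1 a := by
    apply Subtype.ext
    change dsum s.1 a.1 = pad (n + 1) s.1 * dsum 1 a.1
    rw [pad_add]
    simp [dsum, submatrix_mul_equiv, fromBlocks_multiply]
  rw [h, classU_mul, classU_padHom, classU_dsumU_one]

end ClassU

section Reduction

variable {A : Type*} [CommCStarAlgebra A]

theorem joinedIn_dsum {m n : ℕ} {g g' : Matrix (Fin m) (Fin m) A} {h h' : Matrix (Fin n) (Fin n) A}
    (H : JoinedIn {g : Matrix (Fin m) (Fin m) A | IsUnit g} g g')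
    (H' : JoinedIn {g : Matrix (Fin n) (Fin n) A | IsUnit g} h h') :
    JoinedIn {g : Matrix (Fin (m + n)) (Fin (m + n)) A | IsUnit g} (dsum g h) (dsum g' h') := by
  obtain ⟨γ, hγ⟩ := H
  obtain ⟨δ, hδ⟩ := H'
  refine ⟨⟨⟨fun t => dsum (γ t) (δ t), ?_⟩, by simp, by simp⟩, fun t => ?_⟩
  · exact Continuous.matrix_submatrix (Continuous.matrix_fromBlocks γ.continuous continuous_const
      continuous_const δ.continuous) _ _
  · exact (isUnit_submatrix_equiv _ _).mpr (isUnit_fromBlocks_zero₂₁.mpr ⟨hγ t, hδ t⟩)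

/-- If the invertible elements of `A` are dense, then a unitary matrix can be joined to a direct
sum: after a small perturbation the last entry is invertible, and then the last row and column are
removed by elementary operations, which are joined to the identity. -/
theorem exists_joined_dsumU (hA : Dense {a : A | IsUnit a}) {n : ℕ} (u : UMat A (n + 1)) :
    ∃ (s : UMat A n) (a : UMat A 1), Joined u (dsumU s a) := by
  set M := u.1.submatrix finSumFinEquiv finSumFinEquiv with hM
  -- `G d` is `u` with last entry `d`.
  let G : A → Matrix (Fin (n + 1)) (Fin (n + 1)) A := fun d =>
    (fromBlocks M.toBlocks₁₁ M.toBlocks₁₂ M.toBlocks₂₁ (diagonal fun _ : Fin 1 => d)).submatrix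
      finSumFinEquiv.symm finSumFinEquiv.symm
  have hG : Continuous G := by
    refine Continuous.matrix_submatrix (Continuous.matrix_fromBlocks continuous_const
      continuous_const continuous_const ?_) _ _
    exact Continuous.matrix_diagonal (continuous_pi fun _ => continuous_id)
  have hGu : G (M.toBlocks₂₂ 0 0) = u.1 := by
    have h1 : (diagonal fun _ : Fin 1 => M.toBlocks₂₂ 0 0) = M.toBlocks₂₂ := by
      ext i j
      rw [Subsingleton.elim i 0, Subsingleton.elim j 0, diagonal_apply_eq]
    simp only [G, h1, fromBlocks_toBlocks]
    rw [hM, submatrix_submatrix]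
    simp
  have hu : IsUnit u.1 := (Unitary.toUnits u).isUnit
  obtain ⟨ε, hε, hball⟩ := Metric.isOpen_iff.mp ((isOpen_isUnit_matrix (n + 1)).preimage hG)
    (M.toBlocks₂₂ 0 0) (by rw [Set.mem_preimage, hGu]; exact hu)
  obtain ⟨d, hd, hdu⟩ := Metric.dense_iff.mp hA (M.toBlocks₂₂ 0 0) ε hε
  have J1 : JoinedIn {g : Matrix (Fin (n + 1)) (Fin (n + 1)) A | IsUnit g} u.1 (G d) := by
    rw [← hGu]
    have h1 : JoinedIn (Metric.ball (M.toBlocks₂₂ 0 0) ε) (M.toBlocks₂₂ 0 0) d :=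
      ((convex_ball _ _).isPathConnected ⟨_, hd⟩).joinedIn _ (Metric.mem_ball_self hε) _ hd
    obtain ⟨γ, hγ⟩ := h1
    exact ⟨γ.map hG, fun t => hball (hγ t)⟩
  obtain ⟨d, rfl⟩ := hdu
  set D : Matrix (Fin 1) (Fin 1) A := diagonal fun _ : Fin 1 => (d : A) with hD
  let : Invertible D := ⟨diagonal fun _ => (↑d⁻¹ : A), by simp [hD, diagonal_mul_diagonal],
    by simp [hD, diagonal_mul_diagonal]⟩
  set S := M.toBlocks₁₁ - M.toBlocks₁₂ * ⅟D * M.toBlocks₂₁ with hS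
  -- `P` joins `S ⊕ D`, with the Schur complement `S`, to the LDU factorization of `G d`.
  let P : ℝ → Matrix (Fin n ⊕ Fin 1) (Fin n ⊕ Fin 1) A := fun t =>
    fromBlocks 1 ((t : ℂ) • (M.toBlocks₁₂ * ⅟D)) 0 1 * fromBlocks S 0 0 D *
      fromBlocks 1 0 ((t : ℂ) • (⅟D * M.toBlocks₂₁)) 1
  have hP : Continuous P := by
    refine (Continuous.matrix_mul ?_ continuous_const).matrix_mul ?_ <;>
      refine Continuous.matrix_fromBlocks ?_ ?_ ?_ ?_ <;> fun_prop
  have hP0 : (P 0).submatrix finSumFinEquiv.symm finSumFinEquiv.symm = dsum S D := by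
    simp [P, fromBlocks_one, dsum]
  have hP1 : (P 1).submatrix finSumFinEquiv.symm finSumFinEquiv.symm = G d := by
    simp only [P, G, Complex.ofReal_one, one_smul, hS]
    rw [← fromBlocks_eq_of_invertible₂₂]
  have hGd : IsUnit (G d) := J1.target_mem
  have hunit : ∀ t, IsUnit (P t) ↔ IsUnit (fromBlocks S 0 0 D) := fun t => by
    have hl : IsUnit (fromBlocks (1 : Matrix (Fin n) (Fin n) A)
        ((t : ℂ) • (M.toBlocks₁₂ * ⅟D)) 0 (1 : Matrix (Fin 1) (Fin 1) A)) :=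
      isUnit_fromBlocks_zero₂₁.mpr ⟨isUnit_one, isUnit_one⟩
    have hr : IsUnit (fromBlocks (1 : Matrix (Fin n) (Fin n) A) 0
        ((t : ℂ) • (⅟D * M.toBlocks₂₁)) (1 : Matrix (Fin 1) (Fin 1) A)) :=
      isUnit_fromBlocks_zero₁₂.mpr ⟨isUnit_one, isUnit_one⟩
    obtain ⟨l, hl⟩ := hl
    obtain ⟨r, hr⟩ := hr
    simp only [P]
    rw [← hl, ← hr, Units.isUnit_mul_units, Units.isUnit_units_mul]
  have hSD : IsUnit (fromBlocks S 0 0 D) := by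
    rw [← hP1, isUnit_submatrix_equiv, hunit] at hGd
    exact hGd
  have J2 : JoinedIn {g : Matrix (Fin (n + 1)) (Fin (n + 1)) A | IsUnit g} (dsum S D) (G d) := by
    refine JoinedIn.ofLine
      (f := fun t => (P t).submatrix finSumFinEquiv.symm finSumFinEquiv.symm)
      (hP.matrix_submatrix _ _).continuousOn hP0 hP1 ?_
    rintro _ ⟨t, -, rfl⟩
    exact (isUnit_submatrix_equiv _ _).mpr ((hunit t).mpr hSD)
  obtain ⟨hSu, hDu⟩ := isUnit_fromBlocks_zero₂₁.mp hSD
  obtain ⟨s, hs⟩ := exists_joinedIn_unitary hSu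
  obtain ⟨a, ha⟩ := exists_joinedIn_unitary hDu
  exact ⟨s, a, joined_of_joinedIn_isUnit (J1.trans (J2.symm.trans (joinedIn_dsum hs ha)))⟩

/-- If the invertible elements of `A` are dense, then every class in `K₁(A)` is the class of a
unitary element of `A`. -/
theorem surjective_classOne (hA : Dense {a : A | IsUnit a}) (z : KOne A) :
    ∃ w : unitary A, classOne w = z := by
  obtain ⟨n, u, rfl⟩ := surjective_classU z
  induction n with
  | zero =>
    refine ⟨1, ?_⟩
    have hu : u = 1 := Subtype.ext (Subsingleton.elim _ _)
    rw [hu, classU_one, classOne_eq_zero_of_joined (Joined.refl 1)]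
  | succ n ih =>
    obtain ⟨s, a, h⟩ := exists_joined_dsumU hA u
    obtain ⟨w, hw⟩ := ih s
    have ha := Unitary.mem_iff.mp a.2
    have h00 : star (a.1 0 0) * a.1 0 0 = 1 := by
      simpa [Matrix.mul_apply, star_eq_conjTranspose] using congrFun (congrFun ha.1 0) 0
    have h00' : a.1 0 0 * star (a.1 0 0) = 1 := by rw [mul_comm, h00]
    refine ⟨w * ⟨a.1 0 0, h00, h00'⟩, ?_⟩
    rw [classOne_mul, hw, classU_eq_of_joined h, classU_dsumU]
    congr 1
    change classU (oneByOne _) = _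
    congr 1
    ext i j
    rw [Subsingleton.elim i 0, Subsingleton.elim j 0]
    exact diagonal_apply_eq _ _

/-- A unitary element of a commutative C⋆-algebra `A` whose class in `K₁(A)` vanishes is joined to
`1`, as the determinant of a stabilization. -/
theorem joined_one_of_classOne_eq_zero {w : unitary A} (h : classOne w = 0) : Joined 1 w := by
  obtain ⟨n, u, hu, huw⟩ := (QuotientGroup.eq_one_iff _).mp h
  obtain ⟨k, hn, h1, hk⟩ := Quotient.exact huw
  change n ≤ k at hn
  change 1 ≤ k at h1
  change padHom A n k hn u = padHom A 1 k h1 (oneByOne w) at hk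
  have hj := joined_one_padHom hn hu
  rw [hk] at hj
  have hdet : ∀ v : UMat A k, v.1.det ∈ unitary A := fun v => by
    have hv := Unitary.mem_iff.mp v.2
    rw [star_eq_conjTranspose] at hv
    rw [Unitary.mem_iff, ← det_conjTranspose, ← det_mul, ← det_mul, hv.1, hv.2, det_one]
    exact ⟨rfl, rfl⟩
  have hc : Continuous fun v : UMat A k => (⟨v.1.det, hdet v⟩ : unitary A) :=
    (continuous_subtype_val.matrix_det).subtype_mk _
  convert! hj.map hc using 1
  · exact Subtype.ext det_one.symm
  · apply Subtype.ext
    change (w : A) = (pad k (oneByOne w).1).det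
    obtain ⟨l, rfl⟩ := Nat.exists_eq_add_of_le h1
    rw [pad_add, dsum, det_submatrix_equiv_self, det_fromBlocks_zero₂₁, det_one, mul_one]
    simp [oneByOne]

end Reduction

end CStarK

/-! ### Logarithms of circle-valued functions -/

theorem eq_of_forall_exists_int_mul_two_pi {f : ℝ → ℝ} (hf : Continuous f)
    (h : ∀ x, ∃ m : ℤ, f x = m * (2 * Real.pi)) (x y : ℝ) : f x = f y := by
  have hpi : 2 * Real.pi ≠ 0 := by positivity
  have key : f x / (2 * Real.pi) = f y / (2 * Real.pi) :=
    (isPreconnected_univ (α := ℝ)).constant_of_mapsTo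
      (T := Set.range (Int.cast : ℤ → ℝ)) (f := fun x => f x / (2 * Real.pi))
      Int.isClosedEmbedding_coe_real.isEmbedding.isDiscrete_range (by fun_prop)
      (fun x _ => by
        obtain ⟨m, hm⟩ := h x
        exact ⟨m, by simp only [hm, mul_div_cancel_right₀ _ hpi]⟩) (Set.mem_univ x) (Set.mem_univ y)
  exact (div_left_inj' hpi).mp key

/-- A circle-valued function on the circle is `z ↦ z ^ n` up to a function with a logarithm. -/
theorem Circle.exists_eq_zpow_mul_exp (v : C(Circle, Circle)) :
    ∃ (n : ℤ) (h : C(Circle, ℝ)), ∀ z, v z = z ^ n * Circle.exp (h z) := by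
  obtain ⟨e₀, he₀⟩ := Circle.exp_surjective (v (Circle.exp 0))
  obtain ⟨θ, ⟨-, hθ⟩, -⟩ := Circle.isCoveringMap_exp.existsUnique_continuousMap_lifts
    (v.comp Circle.exp) 0 e₀ he₀
  have hθ' : ∀ x, Circle.exp (θ x) = v (Circle.exp x) := fun x => congrFun hθ x
  -- The increment of the lift over a period is a constant multiple of `2π`.
  have hper : ∀ x, ∃ n : ℤ, θ (x + 2 * Real.pi) = θ x + n * (2 * Real.pi) := fun x => by
    rw [← Circle.exp_eq_exp, hθ', hθ', Circle.periodic_exp]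
  have hconst : ∀ x, θ (x + 2 * Real.pi) - θ x = θ (0 + 2 * Real.pi) - θ 0 := fun x => by
    refine eq_of_forall_exists_int_mul_two_pi (f := fun x => θ (x + 2 * Real.pi) - θ x)
      (by fun_prop) (fun x => ?_) x 0
    obtain ⟨n, hn⟩ := hper x
    exact ⟨n, by rw [hn, add_sub_cancel_left]⟩
  obtain ⟨n, hn⟩ := hper 0
  have hperiodic : Function.Periodic (fun x => θ x - n * x) (2 * Real.pi) := fun x => by
    have := hconst x
    rw [hn] at this
    simp only
    linarith
  have hfac : ∀ x y, Circle.exp x = Circle.exp y → θ x - n * x = θ y - n * y := fun x y hxy => by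
    obtain ⟨m, hm⟩ := Circle.exp_eq_exp.mp hxy
    rw [hm]
    exact hperiodic.int_mul m y
  have hq : Topology.IsQuotientMap Circle.exp :=
    Circle.isCoveringMap_exp.isQuotientMap Circle.exp_surjective
  let h : C(Circle, ℝ) := hq.lift ⟨fun x => θ x - n * x, by fun_prop⟩ hfac
  have hh : ∀ x, h (Circle.exp x) = θ x - n * x := fun x =>
    DFunLike.congr_fun (hq.lift_comp ⟨fun x => θ x - n * x, by fun_prop⟩ hfac) x
  refine ⟨n, h, fun z => ?_⟩
  obtain ⟨x, rfl⟩ := Circle.exp_surjective z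
  rw [hh, ← hθ', ← Circle.exp_zsmul, ← Circle.exp_add]
  congr 1
  simp

/-- A power `z ↦ z ^ n` on the circle has a logarithm only for `n = 0`. -/
theorem Circle.eq_zero_of_zpow_eq_exp {n : ℤ} {h : Circle → ℝ} (hc : Continuous h)
    (hn : ∀ z, z ^ n = Circle.exp (h z)) : n = 0 := by
  have h1 : ∀ x : ℝ, ∃ m : ℤ, n * x = h (Circle.exp x) + m * (2 * Real.pi) := fun x => by
    rw [← Circle.exp_eq_exp, ← hn, ← Circle.exp_zsmul]
    simp
  have h2 : ∀ x : ℝ, n * x - h (Circle.exp x) = n * 0 - h (Circle.exp 0) := fun x => by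
    refine eq_of_forall_exists_int_mul_two_pi (f := fun x => n * x - h (Circle.exp x))
      (by fun_prop) (fun x => ?_) x 0
    obtain ⟨m, hm⟩ := h1 x
    exact ⟨m, by rw [hm, add_sub_cancel_left]⟩
  have h3 := h2 (2 * Real.pi)
  rw [Circle.exp_two_pi, Circle.exp_zero] at h3
  have h4 : (n : ℝ) * (2 * Real.pi) = 0 := by linarith
  simpa [Real.pi_ne_zero] using h4

/-- Every circle-valued function on the extended real line has a logarithm. -/
theorem EReal.exists_eq_circleExp (W : C(EReal, Circle)) :
    ∃ h : C(EReal, ℝ), ∀ x, W x = Circle.exp (h x) := by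
  let e := EReal.homeomorphUnitInterval
  let γ : C(unitInterval, Circle) := W.comp ⟨e.symm, e.symm.continuous⟩
  obtain ⟨e₀, he₀⟩ := Circle.exp_surjective (γ 0)
  obtain ⟨Γ, hΓ, -⟩ := Circle.isCoveringMap_exp.exists_path_lifts γ e₀ he₀.symm
  refine ⟨Γ.comp ⟨e, e.continuous⟩, fun x => ?_⟩
  have := congrFun hΓ (e x)
  simp only [Function.comp_apply, γ, ContinuousMap.comp_apply, ContinuousMap.coe_mk,
    e.symm_apply_apply] at this
  exact this.symm

namespace SpiralSpace

/-- A circle-valued function on `X` that has logarithms on both boundary circles has a logarithm: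
after division by the exponential of an extension of the two logarithms it is trivial on
both circles, hence a function of the coordinate in `[-∞, +∞]`. -/
theorem exists_eq_circleExp (w : C(SpiralSpace, Circle)) {h₁ h₂ : C(Circle, ℝ)}
    (hw₁ : ∀ z, w (circleTop z) = Circle.exp (h₁ z))
    (hw₂ : ∀ z, w (circleBot z) = Circle.exp (h₂ z)) :
    ∃ h : C(SpiralSpace, ℝ), ∀ p, w p = Circle.exp (h p) := by
  have hcl : Topology.IsClosedEmbedding (Sum.elim circleTop circleBot) := by
    refine Continuous.isClosedEmbedding (by fun_prop) ?_
    refine Function.Injective.sumElim ?_ ?_ ?_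
    · exact fun a b hab => congrArg (fun p : SpiralSpace => p.1.2) hab
    · exact fun a b hab => congrArg (fun p : SpiralSpace => p.1.2) hab
    · exact fun a b hab => by
        have := congrArg (fun p : SpiralSpace => p.1.1) hab
        exact top_ne_bot this
  obtain ⟨g, hg⟩ := ContinuousMap.exists_extension hcl
    ⟨Sum.elim h₁ h₂, by fun_prop⟩
  have hg₁ : ∀ z, g (circleTop z) = h₁ z := fun z => DFunLike.congr_fun hg (Sum.inl z)
  have hg₂ : ∀ z, g (circleBot z) = h₂ z := fun z => DFunLike.congr_fun hg (Sum.inr z)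
  let u : C(SpiralSpace, Circle) := ⟨fun p => w p * (Circle.exp (g p))⁻¹, by fun_prop⟩
  have hu₁ : ∀ z, u (circleTop z) = 1 := fun z => by
    change w (circleTop z) * (Circle.exp (g (circleTop z)))⁻¹ = 1
    rw [hw₁, hg₁, mul_inv_cancel]
  have hu₂ : ∀ z, u (circleBot z) = 1 := fun z => by
    change w (circleBot z) * (Circle.exp (g (circleBot z)))⁻¹ = 1
    rw [hw₂, hg₂, mul_inv_cancel]
  let π : C(SpiralSpace, EReal) := ⟨fun p => p.1.1, by fun_prop⟩
  have hπ : Topology.IsQuotientMap π := by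
    refine (Continuous.isClosedMap π.continuous).isQuotientMap π.continuous fun x => ?_
    induction x using EReal.rec with
    | bot => exact ⟨circleBot 1, rfl⟩
    | top => exact ⟨circleTop 1, rfl⟩
    | coe x => exact ⟨ofReal x, rfl⟩
  have hfac : ∀ p q, π p = π q → u p = u q := by
    intro p q hpq
    induction p using cases_ofReal_circle with
    | h x =>
      induction q using cases_ofReal_circle with
      | h y =>
        have : x = y := EReal.coe_injective hpq
        rw [this]
      | htop z => exact absurd hpq (EReal.coe_ne_top x)
      | hbot z => exact absurd hpq (EReal.coe_ne_bot x)
    | htop z =>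
      induction q using cases_ofReal_circle with
      | h y => exact absurd hpq.symm (EReal.coe_ne_top y)
      | htop z' => rw [hu₁, hu₁]
      | hbot z' => exact absurd hpq top_ne_bot
    | hbot z =>
      induction q using cases_ofReal_circle with
      | h y => exact absurd hpq.symm (EReal.coe_ne_bot y)
      | htop z' => exact absurd hpq bot_ne_top
      | hbot z' => rw [hu₂, hu₂]
  obtain ⟨k, hk⟩ := EReal.exists_eq_circleExp (hπ.lift u hfac)
  refine ⟨k.comp π + g, fun p => ?_⟩
  have h1 : u p = Circle.exp (k (π p)) := by
    rw [← hk]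
    exact (DFunLike.congr_fun (hπ.lift_comp u hfac) p).symm
  change w p = Circle.exp (k (π p) + g p)
  rw [Circle.exp_add, ← h1]
  exact (inv_mul_cancel_right _ _).symm

theorem lCircle_circleTop (z : Circle) : lCircle (circleTop z) = z := by
  simp [lCircle, circleTop]

theorem lCircle_circleBot (z : Circle) : lCircle (circleBot z) = 1 := by
  simp [lCircle, circleBot]

theorem lTildeCircle_circleTop (z : Circle) : lTildeCircle (circleTop z) = 1 := by
  simp [lTildeCircle, circleTop]

theorem lTildeCircle_circleBot (z : Circle) : lTildeCircle (circleBot z) = z := by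
  simp [lTildeCircle, circleBot]

/-- Every circle-valued function on `X` is a product of powers of `l` and `l̃` and a function with
a logarithm. -/
theorem exists_eq_zpow_mul_zpow_mul_exp (w : C(SpiralSpace, Circle)) :
    ∃ (m n : ℤ) (h : C(SpiralSpace, ℝ)), ∀ p,
      w p = lCircle p ^ m * lTildeCircle p ^ n * Circle.exp (h p) := by
  obtain ⟨m, h₁, hm⟩ := Circle.exists_eq_zpow_mul_exp (w.comp circleTop)
  obtain ⟨n, h₂, hn⟩ := Circle.exists_eq_zpow_mul_exp (w.comp circleBot)
  obtain ⟨h, hh⟩ := exists_eq_circleExp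
    ⟨fun p => (lCircle p ^ m * lTildeCircle p ^ n)⁻¹ * w p, by fun_prop⟩ (h₁ := h₁) (h₂ := h₂)
    (fun z => by
      simp only [ContinuousMap.coe_mk, lCircle_circleTop, lTildeCircle_circleTop, one_zpow,
        mul_one, inv_mul_eq_iff_eq_mul]
      exact hm z)
    (fun z => by
      simp only [ContinuousMap.coe_mk, lCircle_circleBot, lTildeCircle_circleBot, one_zpow,
        one_mul, inv_mul_eq_iff_eq_mul]
      exact hn z)
  exact ⟨m, n, h, fun p => by rw [← hh p]; exact (mul_inv_cancel_left _ _).symm⟩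

/-! ### The group `K₁` of `C(X)` -/

theorem surjective_toUnitary : Function.Surjective toUnitary := by
  intro u
  have hu : ∀ p, ‖u.1 p‖ = 1 := fun p => by
    have h1 : star (u.1 p) * u.1 p = 1 :=
      DFunLike.congr_fun (Unitary.star_mul_self_of_mem u.2) p
    rw [Complex.star_def, Complex.conj_mul'] at h1
    have h2 : ‖u.1 p‖ ^ 2 = 1 := by exact_mod_cast h1
    exact (pow_eq_one_iff_of_nonneg (norm_nonneg _) two_ne_zero).mp h2
  exact ⟨⟨fun p => ⟨u.1 p, mem_sphere_zero_iff_norm.mpr (hu p)⟩, by fun_prop⟩, rfl⟩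

/-- The circle-valued functions as unitary elements of `C(X)`, as a homomorphism. -/
def toUnitaryHom : C(SpiralSpace, Circle) →* unitary C(SpiralSpace, ℂ) where
  toFun := toUnitary
  map_one' := rfl
  map_mul' _ _ := rfl

theorem joined_one_toUnitary_exp (h : C(SpiralSpace, ℝ)) :
    Joined 1 (toUnitary (Circle.exp.comp h)) := by
  let F : C(ℝ × SpiralSpace, ℂ) := ⟨fun q => Circle.exp (q.1 * h q.2), by fun_prop⟩
  have hc : Continuous fun t : ℝ => toUnitary (Circle.exp.comp (t • h)) :=
    Continuous.subtype_mk F.curry.continuous _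
  have h0 : toUnitary (Circle.exp.comp ((0 : ℝ) • h)) = 1 := by
    rw [zero_smul]
    ext p
    simp [toUnitary]
  have h1 : toUnitary (Circle.exp.comp ((1 : ℝ) • h)) = toUnitary (Circle.exp.comp h) := by
    rw [one_smul]
  rw [← h0, ← h1]
  exact (PathConnectedSpace.joined (0 : ℝ) 1).map hc

/-- A unitary element of `C(X)` that is joined to `1` has a logarithm. -/
theorem exists_eq_circleExp_of_joined {u : unitary C(SpiralSpace, ℂ)} (hu : Joined 1 u) :
    ∃ h : C(SpiralSpace, ℝ), ∀ p, u.1 p = Circle.exp (h p) := by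
  obtain ⟨L, rfl⟩ := Unitary.mem_pathComponentOne_iff.mp hu
  clear hu
  induction L with
  | nil => exact ⟨0, fun p => by simp⟩
  | cons a L ih =>
    obtain ⟨h, hh⟩ := ih
    refine ⟨⟨fun p => (a.1 p).re, by fun_prop⟩ + h, fun p => ?_⟩
    let ev : C(SpiralSpace, ℂ) →+* ℂ := ⟨⟨⟨fun f => f p, rfl⟩, fun _ _ => rfl⟩, rfl, fun _ _ => rfl⟩
    have hev : Continuous ev := continuous_eval_const p
    have ha : ((a.1 p).re : ℂ) = a.1 p :=
      Complex.conj_eq_iff_re.mp (DFunLike.congr_fun a.2 p)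
    have h1 : (selfAdjoint.expUnitary a).1 p = Circle.exp (a.1 p).re := by
      rw [selfAdjoint.expUnitary_coe, Circle.coe_exp, ha]
      refine (NormedSpace.map_exp ev hev _).trans ?_
      rw [← Complex.exp_eq_exp_ℂ]
      congr 1
      exact mul_comm _ _
    rw [List.map_cons, List.prod_cons]
    change (selfAdjoint.expUnitary a).1 p * _ = ((Circle.exp ((a.1 p).re + h p) : Circle) : ℂ)
    rw [h1, hh p, Circle.exp_add, Circle.coe_mul]

theorem zsmul_classOne_add_zsmul_classOne (m n : ℤ) :
    m • CStarK.classOne l + n • CStarK.classOne lTilde =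
      CStarK.classOne (toUnitary (lCircle ^ m * lTildeCircle ^ n)) := by
  rw [← CStarK.classOne_zpow, ← CStarK.classOne_zpow, ← CStarK.classOne_mul]
  change _ = CStarK.classOne (toUnitaryHom (lCircle ^ m * lTildeCircle ^ n))
  rw [map_mul, map_zpow, map_zpow]
  rfl

/-- The classes of `l` and `l̃` are independent: a logarithm of `l ^ m * l̃ ^ n` restricts to
logarithms of `z ↦ z ^ m` and `z ↦ z ^ n` on the boundary circles. -/
theorem eq_zero_of_zsmul_classOne_add_eq_zero {m n : ℤ}
    (h : m • CStarK.classOne l + n • CStarK.classOne lTilde = 0) : m = 0 ∧ n = 0 := by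
  rw [zsmul_classOne_add_zsmul_classOne] at h
  obtain ⟨k, hk⟩ := exists_eq_circleExp_of_joined (CStarK.joined_one_of_classOne_eq_zero h)
  have hk' : ∀ p, lCircle p ^ m * lTildeCircle p ^ n = Circle.exp (k p) := fun p =>
    Circle.ext (hk p)
  constructor
  · refine Circle.eq_zero_of_zpow_eq_exp (k.comp circleTop).continuous fun z => ?_
    simpa [lCircle_circleTop, lTildeCircle_circleTop] using hk' (circleTop z)
  · refine Circle.eq_zero_of_zpow_eq_exp (k.comp circleBot).continuous fun z => ?_
    simpa [lCircle_circleBot, lTildeCircle_circleBot] using hk' (circleBot z)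

theorem bijective_zsmul_classOne_add_zsmul_classOne : Function.Bijective (fun mn : ℤ × ℤ =>
    mn.1 • CStarK.classOne l + mn.2 • CStarK.classOne lTilde) := by
  constructor
  · rintro ⟨m, n⟩ ⟨m', n'⟩ h
    have h1 : (m - m') • CStarK.classOne l + (n - n') • CStarK.classOne lTilde = 0 := by
      simp only at h
      rw [sub_smul, sub_smul, sub_add_sub_comm, h, sub_self]
    obtain ⟨h2, h3⟩ := eq_zero_of_zsmul_classOne_add_eq_zero h1
    exact Prod.ext (sub_eq_zero.mp h2) (sub_eq_zero.mp h3)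
  · intro z
    obtain ⟨u, rfl⟩ := CStarK.surjective_classOne dense_isUnit z
    obtain ⟨w, rfl⟩ := surjective_toUnitary u
    obtain ⟨m, n, h, hw⟩ := exists_eq_zpow_mul_zpow_mul_exp w
    refine ⟨(m, n), ?_⟩
    have h1 : w = lCircle ^ m * lTildeCircle ^ n * Circle.exp.comp h :=
      ContinuousMap.ext hw
    have h2 : toUnitary w = toUnitary (lCircle ^ m * lTildeCircle ^ n) *
        toUnitary (Circle.exp.comp h) := by
      rw [h1]
      exact map_mul toUnitaryHom _ _
    rw [h2, CStarK.classOne_mul, CStarK.classOne_eq_zero_of_joined (joined_one_toUnitary_exp h),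
      add_zero, ← zsmul_classOne_add_zsmul_classOne]

end SpiralSpace

end

theorem mainTheorem4 :
    Function.Bijective (fun n : ℤ =>
      n • CStarK.classZero (1 : C(SpiralSpace, ℂ)) (IsStarProjection.one _)) ∧
    Function.Bijective (fun mn : ℤ × ℤ =>
      mn.1 • CStarK.classOne SpiralSpace.l + mn.2 • CStarK.classOne SpiralSpace.lTilde) := by
  have : Nonempty SpiralSpace := ⟨SpiralSpace.ofReal 0⟩
  exact ⟨CStarK.bijective_zsmul_classZero_one SpiralSpace.dense_isUnit,
    SpiralSpace.bijective_zsmul_classOne_add_zsmul_classOne⟩
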